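/- Let $s=\{\xi\in\mathbb C^{\mathbb N}: |\xi|_q:=(\sum_{j\ge 1}|\xi_j|^2j^{2q})^{1/2}<\infty \text{ for all } q\in\mathbb N_0\}$ be the Fréchet space of rapidly decreasing sequences, with the norms $|\cdot|_q$, and let $s'=\{\xi\in\mathbb C^{\mathbb N}: |\xi|'_q:=(\sum_{j\ge 1}|\xi_j|^2j^{-2q})^{1/2}<\infty \text{ for some } q\in\mathbb N_0\}$ be the space of slowly increasing sequences, with the locally convex inductive limit topology given by the norms $|\cdot|'_q$. Let $L(s',s)$ be the space of continuous linear operators $x:s'\to s$, with the topology given by the norms $\|x\|_q=\sup_{|\xi|'_q\le 1}|x\xi|_q$ $(q\in\mathbb N_0)$, with the multiplication $xy=x\circ j\circ y$, where $j:s\hookrightarrow s'$ is the inclusion, and with the Hilbert space involution $x\mapsto x^*$ obtained by regarding $x$ as a bounded operator on $\ell_2$ through $\ell_2\hookrightarrow s'\to s\hookrightarrow \ell_2$. Let $A$ be a closed commutative ${}^*$-subalgebra of $L(s',s)$ (not assumed to contain a unit). Let $\mathcal P$ be the set of nonzero elements of $A$ that are orthogonal projections on $\ell_2$, and let $\mathcal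 M$ be the set of minimal elements of $\mathcal P$ with respect to the order $P\preceq Q\Leftrightarrow PQ=QP=P$. Then $\mathcal M$ is at most countable and, for every enumeration of $\mathcal M$, it is a Schauder basis of $A$ (the canonical Schauder basis): every $x\in A$ has a unique expansion $x=\sum_{P\in\mathcal M}c_P(x)P$, with the series, in the order of the enumeration, converging in $A$, and the coefficient functionals $x\mapsto c_P(x)$ are continuous. Moreover, the set of all nonzero ${}^*$-multiplicative linear functionals on $A$ (the nonzero linear $\varphi:A\to\mathbb C$ with $\varphi(xy)=\varphi(x)\varphi(y)$ and $\varphi(x^*)=\overline{\varphi(x)}$, continuity not being assumed) is exactly the set $\{c_P:P\in\mathcal M\}$ of coefficient functionals. -/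

import Mathlib

open Filter Topology

namespace SmoothOps

noncomputable section

/-! ### The weighted sequence spaces

Sequences are indexed by `j = 0, 1, 2, …`; the coordinate with index `j` is the `(j + 1)`-st
coordinate, so its weight is a power of `j + 1`. -/

/-- `|ξ|_q = (∑_j |ξ_j|² (j+1)^{2q})^{1/2}`, for an integer `q`. For `q : ℕ` the norm `|·|_q` is
`wnorm q` and the dual norm `|·|'_q` is `wnorm (-q)`. Meaningful on `weighted q`. -/
def wnorm (q : ℤ) (ξ : ℕ → ℂ) : ℝ :=
  Real.sqrt (∑' j : ℕ, ‖ξ j‖ ^ 2 * ((j : ℝ) + 1) ^ (2 * q))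

/-- `ξ j * (j+1)^q`, so that `|ξ|_q` is the `ℓ²`-norm of this sequence. -/
def scale (q : ℤ) (ξ : ℕ → ℂ) : ℕ → ℂ := fun j => (((j : ℝ) + 1) ^ q : ℝ) * ξ j

theorem norm_scale_sq (q : ℤ) (ξ : ℕ → ℂ) (j : ℕ) :
    ‖scale q ξ j‖ ^ 2 = ‖ξ j‖ ^ 2 * ((j : ℝ) + 1) ^ (2 * q) := by
  have h : (0 : ℝ) < (j : ℝ) + 1 := by positivity
  rw [scale, norm_mul, Complex.norm_real, Real.norm_of_nonneg (by positivity), mul_pow, mul_comm,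
    mul_comm 2 q, zpow_mul]
  norm_cast

theorem memlp_iff (f : ℕ → ℂ) : Memℓp f 2 ↔ Summable fun j => ‖f j‖ ^ 2 := by
  rw [memℓp_gen_iff (by norm_num)]
  simp

theorem lp_norm_eq (f : lp (fun _ : ℕ => ℂ) 2) : ‖f‖ = Real.sqrt (∑' j, ‖f j‖ ^ 2) := by
  rw [lp.norm_eq_tsum_rpow (by norm_num), Real.sqrt_eq_rpow]
  simp

theorem memlp_scale_iff (q : ℤ) (ξ : ℕ → ℂ) :
    Memℓp (scale q ξ) 2 ↔ Summable fun j : ℕ => ‖ξ j‖ ^ 2 * ((j : ℝ) + 1) ^ (2 * q) := by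
  rw [memlp_iff]; simp only [norm_scale_sq]

theorem scale_add (q : ℤ) (ξ η : ℕ → ℂ) : scale q (ξ + η) = scale q ξ + scale q η := by
  ext j; simp [scale, mul_add]

theorem scale_smul (q : ℤ) (c : ℂ) (ξ : ℕ → ℂ) : scale q (c • ξ) = c • scale q ξ := by
  ext j; simp only [scale, Pi.smul_apply, smul_eq_mul]; ring

/-- The space of the sequences `ξ` with `|ξ|_q < ∞`. -/
def weighted (q : ℤ) : Submodule ℂ (ℕ → ℂ) where
  carrier := {ξ | Summable fun j : ℕ => ‖ξ j‖ ^ 2 * ((j : ℝ) + 1) ^ (2 * q)}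
  add_mem' {ξ η} hξ hη := by
    rw [Set.mem_ofPred_eq, ← memlp_scale_iff] at *
    rw [scale_add]; exact hξ.add hη
  zero_mem' := by simp
  smul_mem' c ξ hξ := by
    rw [Set.mem_ofPred_eq, ← memlp_scale_iff] at *
    rw [scale_smul]; exact hξ.const_smul c

theorem mem_weighted {q : ℤ} {ξ : ℕ → ℂ} : ξ ∈ weighted q ↔ Memℓp (scale q ξ) 2 :=
  (memlp_scale_iff q ξ).symm

theorem wnorm_eq {q : ℤ} {ξ : ℕ → ℂ} (h : ξ ∈ weighted q) :
    wnorm q ξ = ‖(⟨scale q ξ, mem_weighted.1 h⟩ : lp (fun _ : ℕ => ℂ) 2)‖ := by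
  rw [lp_norm_eq, wnorm]; simp only [norm_scale_sq]

theorem wnorm_nonneg (q : ℤ) (ξ : ℕ → ℂ) : 0 ≤ wnorm q ξ := Real.sqrt_nonneg _

theorem wnorm_zero (q : ℤ) : wnorm q 0 = 0 := by simp [wnorm]

theorem wnorm_add_le {q : ℤ} {ξ η : ℕ → ℂ} (hξ : ξ ∈ weighted q) (hη : η ∈ weighted q) :
    wnorm q (ξ + η) ≤ wnorm q ξ + wnorm q η := by
  rw [wnorm_eq hξ, wnorm_eq hη, wnorm_eq (add_mem hξ hη)]
  refine le_trans (le_of_eq ?_) (norm_add_le _ _)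
  congr 1
  exact Subtype.ext (scale_add q ξ η)

theorem wnorm_smul {q : ℤ} (c : ℂ) (ξ : ℕ → ℂ) : wnorm q (c • ξ) = ‖c‖ * wnorm q ξ := by
  have : (fun j : ℕ => ‖(c • ξ) j‖ ^ 2 * ((j : ℝ) + 1) ^ (2 * q))
      = fun j : ℕ => ‖c‖ ^ 2 * (‖ξ j‖ ^ 2 * ((j : ℝ) + 1) ^ (2 * q)) := by
    ext j; simp [mul_pow]; ring
  rw [wnorm, this, tsum_mul_left, Real.sqrt_mul (by positivity), Real.sqrt_sq (norm_nonneg c),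
    wnorm]

theorem norm_mul_le_wnorm {q : ℤ} {ξ : ℕ → ℂ} (h : ξ ∈ weighted q) (j : ℕ) :
    ‖ξ j‖ * ((j : ℝ) + 1) ^ q ≤ wnorm q ξ := by
  have hj : (0 : ℝ) < (j : ℝ) + 1 := by positivity
  refine Real.le_sqrt_of_sq_le ?_
  have := h.le_tsum j (fun i _ => by positivity)
  refine le_trans (le_of_eq ?_) this
  rw [mul_pow, mul_comm 2 q, zpow_mul]; norm_cast

theorem term_le_term {p q : ℤ} (hpq : p ≤ q) (ξ : ℕ → ℂ) (j : ℕ) :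
    ‖ξ j‖ ^ 2 * ((j : ℝ) + 1) ^ (2 * p) ≤ ‖ξ j‖ ^ 2 * ((j : ℝ) + 1) ^ (2 * q) := by
  have h1 : (1 : ℝ) ≤ (j : ℝ) + 1 := by simp
  have : ((j : ℝ) + 1) ^ (2 * p) ≤ ((j : ℝ) + 1) ^ (2 * q) :=
    zpow_le_zpow_right₀ h1 (by omega)
  gcongr

theorem weighted_mono {p q : ℤ} (hpq : p ≤ q) : weighted q ≤ weighted p := fun ξ hξ =>
  Summable.of_nonneg_of_le (fun j => by positivity) (term_le_term hpq ξ) hξ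

theorem wnorm_mono {p q : ℤ} (hpq : p ≤ q) {ξ : ℕ → ℂ} (h : ξ ∈ weighted q) :
    wnorm p ξ ≤ wnorm q ξ :=
  Real.sqrt_le_sqrt ((weighted_mono hpq h).tsum_le_tsum (term_le_term hpq ξ) h)

/-! ### The space `s` of rapidly decreasing sequences -/

/-- The sequences `ξ` with `|ξ|_q < ∞` for all `q : ℕ`. -/
def rapid : Submodule ℂ (ℕ → ℂ) := ⨅ q : ℕ, weighted q

theorem mem_rapid {ξ : ℕ → ℂ} : ξ ∈ rapid ↔ ∀ q : ℕ, ξ ∈ weighted q := by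
  simp [rapid, Submodule.mem_iInf]

/-- The Fréchet space `s` of rapidly decreasing sequences. -/
def RapidSeq : Type := rapid

instance : AddCommGroup RapidSeq := inferInstanceAs (AddCommGroup rapid)

instance : Module ℂ RapidSeq := inferInstanceAs (Module ℂ rapid)

/-- The norm `|·|_q` on `s`. -/
def RapidSeq.seminorm : SeminormFamily ℂ RapidSeq ℕ := fun q =>
  Seminorm.of (fun ξ => wnorm q ξ.1)
    (fun ξ η => wnorm_add_le (mem_rapid.1 ξ.2 q) (mem_rapid.1 η.2 q))
    (fun c ξ => wnorm_smul c ξ.1)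

instance : TopologicalSpace RapidSeq := RapidSeq.seminorm.moduleFilterBasis.topology

theorem RapidSeq.withSeminorms : WithSeminorms RapidSeq.seminorm := ⟨rfl⟩

instance : IsTopologicalAddGroup RapidSeq := RapidSeq.withSeminorms.topologicalAddGroup

instance : ContinuousSMul ℂ RapidSeq := RapidSeq.withSeminorms.continuousSMul

/-! ### The space `s'` of slowly increasing sequences -/

/-- The sequences `ξ` with `|ξ|'_q < ∞` for some `q : ℕ`. -/
def slow : Submodule ℂ (ℕ → ℂ) where
  carrier := {ξ | ∃ q : ℕ, ξ ∈ weighted (-q)}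
  add_mem' := by
    rintro ξ η ⟨p, hp⟩ ⟨q, hq⟩
    exact ⟨p + q, add_mem (weighted_mono (by push_cast; omega) hp)
      (weighted_mono (by push_cast; omega) hq)⟩
  zero_mem' := ⟨0, zero_mem _⟩
  smul_mem' := by
    rintro c ξ ⟨p, hp⟩
    exact ⟨p, Submodule.smul_mem _ c hp⟩

/-- The space `s'` of slowly increasing sequences. -/
def SlowSeq : Type := slow

instance : AddCommGroup SlowSeq := inferInstanceAs (AddCommGroup slow)

instance : Module ℂ SlowSeq := inferInstanceAs (Module ℂ slow)

/-- The seminorms on `s'` whose restriction to each step `{ξ : |ξ|'_q < ∞}` is continuous for the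
norm `|·|'_q`. -/
def StepContinuous (p : Seminorm ℂ SlowSeq) : Prop :=
  ∀ q : ℕ, ∃ C : ℝ, ∀ ξ : SlowSeq, ξ.1 ∈ weighted (-q) → p ξ ≤ C * wnorm (-q) ξ.1

instance : Nonempty {p : Seminorm ℂ SlowSeq // StepContinuous p} :=
  ⟨⟨0, fun q => ⟨0, fun ξ _ => by simp⟩⟩⟩

/-- The family of all seminorms on `s'` that are continuous on each step. -/
def SlowSeq.seminorm :
    SeminormFamily ℂ SlowSeq {p : Seminorm ℂ SlowSeq // StepContinuous p} := fun p => p.1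

/-- The locally convex inductive limit topology on `s'`. -/
instance : TopologicalSpace SlowSeq := SlowSeq.seminorm.moduleFilterBasis.topology

theorem SlowSeq.withSeminorms : WithSeminorms SlowSeq.seminorm := ⟨rfl⟩

instance : IsTopologicalAddGroup SlowSeq := SlowSeq.withSeminorms.topologicalAddGroup

instance : ContinuousSMul ℂ SlowSeq := SlowSeq.withSeminorms.continuousSMul

theorem rapid_le_slow : rapid ≤ slow := fun _ hξ => ⟨0, by simpa using mem_rapid.1 hξ 0⟩

/-- A continuous seminorm on `s'` is continuous on each step. -/
theorem stepContinuous_of_continuous {p : Seminorm ℂ SlowSeq} (hp : Continuous p) :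
    StepContinuous p := by
  have hsup : ∀ t : Finset {p : Seminorm ℂ SlowSeq // StepContinuous p},
      StepContinuous (t.sup SlowSeq.seminorm) := by
    classical
    intro t
    induction t using Finset.induction_on with
    | empty => exact fun q => ⟨0, fun ξ _ => by simp⟩
    | insert a t _ ih =>
      intro q
      obtain ⟨A, hA⟩ := a.2 q
      obtain ⟨B, hB⟩ := ih q
      refine ⟨max A B, fun ξ hξ => ?_⟩
      rw [Finset.sup_insert, Seminorm.sup_apply]
      have := wnorm_nonneg (-q) ξ.1
      exact max_le ((hA ξ hξ).trans (by gcongr; exact le_max_left _ _))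
        ((hB ξ hξ).trans (by gcongr; exact le_max_right _ _))
  obtain ⟨t, C, -, h⟩ := Seminorm.bound_of_continuous SlowSeq.withSeminorms p hp
  intro q
  obtain ⟨B, hB⟩ := hsup t q
  refine ⟨C * B, fun ξ hξ => (h ξ).trans ?_⟩
  rw [mul_assoc]
  exact mul_le_mul_of_nonneg_left (hB ξ hξ) C.2

/-- A linear map `s' → s` is continuous as soon as it is bounded from each step to each norm. -/
theorem continuous_of_bound (f : SlowSeq →ₗ[ℂ] RapidSeq)
    (h : ∀ q r : ℕ, ∃ C : ℝ, ∀ ξ : SlowSeq, ξ.1 ∈ weighted (-q) →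
      wnorm r (f ξ).1 ≤ C * wnorm (-q) ξ.1) : Continuous f := by
  refine WithSeminorms.continuous_of_continuous_comp RapidSeq.withSeminorms f fun r => ?_
  exact SlowSeq.withSeminorms.continuous_seminorm
    (⟨(RapidSeq.seminorm r).comp f, fun q => h q r⟩ : {p : Seminorm ℂ SlowSeq // StepContinuous p})

theorem bound_of_continuous (f : SlowSeq →L[ℂ] RapidSeq) (q r : ℕ) :
    ∃ C : ℝ, 0 ≤ C ∧ ∀ ξ : SlowSeq, ξ.1 ∈ weighted (-q) →
      wnorm r (f ξ).1 ≤ C * wnorm (-q) ξ.1 := by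
  have hc : Continuous ((RapidSeq.seminorm r).comp (f : SlowSeq →ₗ[ℂ] RapidSeq)) :=
    (RapidSeq.withSeminorms.continuous_seminorm r).comp f.continuous
  obtain ⟨C, hC⟩ := stepContinuous_of_continuous hc q
  refine ⟨max C 0, le_max_right _ _, fun ξ hξ => (hC ξ hξ).trans ?_⟩
  have := wnorm_nonneg (-q) ξ.1
  gcongr
  exact le_max_left _ _

/-- The linear map underlying the canonical inclusion `s ↪ s'`. -/
def inclLinear : RapidSeq →ₗ[ℂ] SlowSeq := Submodule.inclusion rapid_le_slow

theorem continuous_inclLinear : Continuous inclLinear := by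
  refine WithSeminorms.continuous_of_continuous_comp SlowSeq.withSeminorms inclLinear fun p => ?_
  obtain ⟨C, hC⟩ := p.2 0
  refine Seminorm.continuous_of_le (q := C.toNNReal •
    RapidSeq.seminorm 0) ((RapidSeq.withSeminorms.continuous_seminorm 0).const_smul
      C.toNNReal) fun ξ => ?_
  have hv : (inclLinear ξ).1 = ξ.1 := rfl
  have h := hC (inclLinear ξ) (by rw [hv]; simpa using mem_rapid.1 ξ.2 0)
  rw [hv, Nat.cast_zero, neg_zero] at h
  exact h.trans (mul_le_mul_of_nonneg_right (Real.le_coe_toNNReal C) (wnorm_nonneg _ _))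

/-- The canonical inclusion `s ↪ s'`. -/
def incl : RapidSeq →L[ℂ] SlowSeq := ⟨inclLinear, continuous_inclLinear⟩

theorem incl_val (ξ : RapidSeq) : (incl ξ).1 = ξ.1 := rfl

/-! ### The algebra `L(s', s)` -/

/-- The space `L(s', s)` of continuous linear operators from `s'` to `s`. -/
def SmoothOp : Type := SlowSeq →L[ℂ] RapidSeq

/-- An element of `L(s', s)` as a continuous linear map. -/
def SmoothOp.toCLM (x : SmoothOp) : SlowSeq →L[ℂ] RapidSeq := x

instance : AddCommGroup SmoothOp := inferInstanceAs (AddCommGroup (SlowSeq →L[ℂ] RapidSeq))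

instance : Module ℂ SmoothOp := inferInstanceAs (Module ℂ (SlowSeq →L[ℂ] RapidSeq))

theorem SmoothOp.ext {x y : SmoothOp} (h : ∀ ξ, x.toCLM ξ = y.toCLM ξ) : x = y :=
  ContinuousLinearMap.ext h

/-- The unit ball of `|·|'_q` in `s'`. -/
def dualBall (q : ℕ) : Set SlowSeq := {ξ | ξ.1 ∈ weighted (-q) ∧ wnorm (-q) ξ.1 ≤ 1}

/-- `‖x‖_q`, the supremum of `|x ξ|_q` over `|ξ|'_q ≤ 1`. -/
def SmoothOp.opNorm (q : ℕ) (x : SmoothOp) : ℝ :=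
  ⨆ ξ : dualBall q, wnorm q (x.toCLM ξ.1).1

theorem SmoothOp.bddAbove (q : ℕ) (x : SmoothOp) :
    BddAbove (Set.range fun ξ : dualBall q => wnorm q (x.toCLM ξ.1).1) := by
  obtain ⟨C, hC, h⟩ := bound_of_continuous x.toCLM q q
  refine ⟨C, ?_⟩
  rintro _ ⟨ξ, rfl⟩
  refine (h ξ.1 ξ.2.1).trans ?_
  simpa using mul_le_mul_of_nonneg_left ξ.2.2 hC

instance (q : ℕ) : Nonempty (dualBall q) :=
  ⟨⟨0, zero_mem (weighted (-q)), (wnorm_zero _).le.trans zero_le_one⟩⟩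

/-- The norms `‖·‖_q` on `L(s', s)`. -/
def SmoothOp.seminorm : SeminormFamily ℂ SmoothOp ℕ := fun q =>
  Seminorm.of (SmoothOp.opNorm q)
    (fun x y => ciSup_le fun ξ =>
      (wnorm_add_le (mem_rapid.1 (x.toCLM ξ.1).2 q) (mem_rapid.1 (y.toCLM ξ.1).2 q)).trans
        (add_le_add (le_ciSup (x.bddAbove q) ξ) (le_ciSup (y.bddAbove q) ξ)))
    (fun c x => by
      rw [SmoothOp.opNorm, SmoothOp.opNorm, Real.mul_iSup_of_nonneg (norm_nonneg c)]
      exact iSup_congr fun ξ => wnorm_smul c _)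

/-- The Fréchet space topology of `L(s', s)`. -/
instance : TopologicalSpace SmoothOp := SmoothOp.seminorm.moduleFilterBasis.topology

theorem SmoothOp.withSeminorms : WithSeminorms SmoothOp.seminorm := ⟨rfl⟩

instance : IsTopologicalAddGroup SmoothOp := SmoothOp.withSeminorms.topologicalAddGroup

instance : ContinuousSMul ℂ SmoothOp := SmoothOp.withSeminorms.continuousSMul

/-- The product `x · y = x ∘ j ∘ y`, where `j : s ↪ s'` is the inclusion. -/
instance : Mul SmoothOp := ⟨fun x y => x.toCLM.comp (incl.comp y.toCLM)⟩

theorem SmoothOp.mul_apply (x y : SmoothOp) (ξ : SlowSeq) :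
    (x * y).toCLM ξ = x.toCLM (incl (y.toCLM ξ)) := rfl

instance : NonUnitalRing SmoothOp where
  left_distrib x _ _ := SmoothOp.ext fun _ =>
    (congrArg x.toCLM (map_add incl _ _)).trans (map_add x.toCLM _ _)
  right_distrib _ _ _ := rfl
  zero_mul _ := rfl
  mul_zero x := SmoothOp.ext fun _ => (congrArg x.toCLM (map_zero incl)).trans (map_zero x.toCLM)
  mul_assoc _ _ _ := rfl

instance : IsScalarTower ℂ SmoothOp SmoothOp := ⟨fun _ _ _ => rfl⟩

instance : SMulCommClass ℂ SmoothOp SmoothOp :=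
  ⟨fun c x _ => SmoothOp.ext fun _ =>
    ((congrArg x.toCLM (map_smul incl c _)).trans (map_smul x.toCLM c _)).symm⟩

/-! ### The embedding into the bounded operators on `ℓ²` -/

/-- The Hilbert space `ℓ²`. -/
abbrev L2 : Type := lp (fun _ : ℕ => ℂ) 2

theorem scale_zero (ξ : ℕ → ℂ) : scale 0 ξ = ξ := by
  ext j; simp [scale]

theorem mem_weighted_zero {ξ : ℕ → ℂ} : ξ ∈ weighted 0 ↔ Memℓp ξ 2 := by
  rw [mem_weighted, scale_zero]

/-- The inclusion `ℓ² ↪ s'`. -/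
def l2ToSlow : L2 →ₗ[ℂ] SlowSeq where
  toFun f := ⟨f.1, 0, by
    rw [Nat.cast_zero, neg_zero]; exact mem_weighted_zero.2 f.2⟩
  map_add' _ _ := rfl
  map_smul' _ _ := rfl

/-- The inclusion `s ↪ ℓ²`. -/
def rapidToL2 : RapidSeq →ₗ[ℂ] L2 where
  toFun ξ := ⟨ξ.1, mem_weighted_zero.1 (by simpa using mem_rapid.1 ξ.2 0)⟩
  map_add' _ _ := rfl
  map_smul' _ _ := rfl

theorem wnorm_zero_eq (f : L2) : wnorm 0 f.1 = ‖f‖ := by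
  rw [lp_norm_eq]; simp [wnorm]

/-- The operator on `ℓ²` defined by `x`, through `ℓ² ↪ s' → s ↪ ℓ²`. -/
def toL2 (x : SmoothOp) : L2 →L[ℂ] L2 :=
  (rapidToL2 ∘ₗ (x.toCLM : SlowSeq →ₗ[ℂ] RapidSeq) ∘ₗ l2ToSlow).mkContinuousOfExistsBound <| by
    obtain ⟨C, -, h⟩ := bound_of_continuous x.toCLM 0 0
    refine ⟨C, fun f => ?_⟩
    have := h (l2ToSlow f) (by
      rw [Nat.cast_zero, neg_zero]; exact mem_weighted_zero.2 f.2)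
    rw [← wnorm_zero_eq, ← wnorm_zero_eq]
    rw [Nat.cast_zero, neg_zero] at this
    exact this

theorem toL2_apply (x : SmoothOp) (f : L2) : toL2 x f = rapidToL2 (x.toCLM (l2ToSlow f)) := rfl

theorem toL2_mul (x y : SmoothOp) : toL2 (x * y) = toL2 x ∘L toL2 y := rfl

/-- The unit vector `e_j` in `s'`. -/
def unitVec (j : ℕ) : SlowSeq := l2ToSlow (lp.single 2 j 1)

theorem toL2_add (x y : SmoothOp) : toL2 (x + y) = toL2 x + toL2 y := rfl

theorem toL2_smul (c : ℂ) (x : SmoothOp) : toL2 (c • x) = c • toL2 x := rfl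

/-! ### The involution -/

/-- For `η ∈ s'`, the sequence with entries `⟨η, x e_j⟩ = ∑_k η_k * conj ((x e_j)_k)`. -/
def starFun (x : SmoothOp) (η : ℕ → ℂ) (j : ℕ) : ℂ :=
  ∑' k, η k * star ((x.toCLM (unitVec j)).1 k)

theorem pairing {q : ℤ} {ξ η : ℕ → ℂ} (hξ : ξ ∈ weighted q) (hη : η ∈ weighted (-q)) :
    (Summable fun k => η k * star (ξ k)) ∧
      ‖∑' k, η k * star (ξ k)‖ ≤ wnorm (-q) η * wnorm q ξ := by
  let f : L2 := ⟨scale q ξ, mem_weighted.1 hξ⟩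
  let g : L2 := ⟨scale (-q) η, mem_weighted.1 hη⟩
  have h := lp.hasSum_inner (𝕜 := ℂ) f g
  have e : (fun k => η k * star (ξ k)) = fun k => inner ℂ (f k) (g k) := by
    ext k
    have hk : (((k : ℝ) + 1 : ℝ) : ℂ) ≠ 0 := by
      exact_mod_cast (by positivity : (0 : ℝ) < (k : ℝ) + 1).ne'
    show _ = scale (-q) η k * star (scale q ξ k)
    simp only [scale, star_mul', Complex.star_def, Complex.conj_ofReal]
    push_cast at hk ⊢
    rw [zpow_neg]
    field_simp
  rw [e]
  refine ⟨h.summable, ?_⟩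
  rw [h.tsum_eq, wnorm_eq hξ, wnorm_eq hη, mul_comm]
  exact norm_inner_le_norm f g

theorem summable_inv_sq : Summable fun j : ℕ => ((j : ℝ) + 1) ^ (-2 : ℤ) := by
  have := (summable_nat_add_iff 1).2 (Real.summable_one_div_nat_pow.2 one_lt_two)
  refine this.congr fun j => ?_
  rw [zpow_neg]; push_cast; norm_cast; simp

theorem weighted_of_bound {m : ℤ} {K : ℝ} (hK : 0 ≤ K) {ζ : ℕ → ℂ}
    (h : ∀ j : ℕ, ‖ζ j‖ ≤ K * ((j : ℝ) + 1) ^ (-(m + 1))) :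
    ζ ∈ weighted m ∧ wnorm m ζ ≤ K * Real.sqrt (∑' j : ℕ, ((j : ℝ) + 1) ^ (-2 : ℤ)) := by
  have hle : ∀ j : ℕ, ‖ζ j‖ ^ 2 * ((j : ℝ) + 1) ^ (2 * m)
      ≤ K ^ 2 * ((j : ℝ) + 1) ^ (-2 : ℤ) := fun j => by
    have hj : (0 : ℝ) < (j : ℝ) + 1 := by positivity
    calc ‖ζ j‖ ^ 2 * ((j : ℝ) + 1) ^ (2 * m)
        ≤ (K * ((j : ℝ) + 1) ^ (-(m + 1))) ^ 2 * ((j : ℝ) + 1) ^ (2 * m) := by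
          gcongr; exact h j
      _ = K ^ 2 * ((j : ℝ) + 1) ^ (-2 : ℤ) := by
          rw [mul_pow, mul_assoc, ← zpow_natCast (((j : ℝ) + 1) ^ (-(m + 1))), ← zpow_mul,
            ← zpow_add₀ hj.ne']
          congr 2; push_cast; ring
  have hs := summable_inv_sq.mul_left (K ^ 2)
  have hm : ζ ∈ weighted m := Summable.of_nonneg_of_le (fun j => by positivity) hle hs
  refine ⟨hm, (Real.sqrt_le_sqrt (Summable.tsum_le_tsum hle hm hs)).trans ?_⟩
  rw [tsum_mul_left, Real.sqrt_mul (by positivity), Real.sqrt_sq hK]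

theorem unitVec_val (j : ℕ) : (unitVec j).1 = Pi.single j 1 := by
  exact lp.coeFn_single (E := fun _ : ℕ => ℂ) 2 j (1 : ℂ)

theorem wnorm_unitVec (q : ℤ) (j : ℕ) :
    (unitVec j).1 ∈ weighted q ∧ wnorm q (unitVec j).1 = ((j : ℝ) + 1) ^ q := by
  have h : HasSum (fun k : ℕ => ‖(unitVec j).1 k‖ ^ 2 * ((k : ℝ) + 1) ^ (2 * q))
      (((j : ℝ) + 1) ^ (2 * q)) := by
    convert hasSum_ite_eq j (((j : ℝ) + 1) ^ (2 * q)) using 2 with k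
    rw [unitVec_val]
    by_cases hk : k = j
    · subst hk; simp
    · simp [hk]
  refine ⟨h.summable, ?_⟩
  rw [wnorm, h.tsum_eq, mul_comm 2 q, zpow_mul]
  exact Real.sqrt_sq (by positivity)

theorem starFun_bound (x : SmoothOp) (q m : ℕ) : ∃ C : ℝ, 0 ≤ C ∧ ∀ η ∈ weighted (-q),
    starFun x η ∈ weighted m ∧ wnorm m (starFun x η) ≤ C * wnorm (-q) η := by
  obtain ⟨C, hC, h⟩ := bound_of_continuous x.toCLM (m + 1) q
  refine ⟨C * Real.sqrt (∑' j : ℕ, ((j : ℝ) + 1) ^ (-2 : ℤ)), by positivity, fun η hη => ?_⟩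
  have hn := wnorm_nonneg (-q) η
  have key : ∀ j : ℕ, ‖starFun x η j‖
      ≤ (C * wnorm (-q) η) * ((j : ℝ) + 1) ^ (-((m : ℤ) + 1)) := fun j => by
    have h1 := (pairing (mem_rapid.1 (x.toCLM (unitVec j)).2 q) hη).2
    have h2 := h (unitVec j) (wnorm_unitVec _ j).1
    rw [(wnorm_unitVec _ j).2] at h2
    push_cast at h2
    calc _ ≤ _ := h1
      _ ≤ wnorm (-q) η * (C * ((j : ℝ) + 1) ^ (-((m : ℤ) + 1))) := by gcongr
      _ = _ := by ring
  have := weighted_of_bound (by positivity) key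
  exact ⟨this.1, this.2.trans (le_of_eq (by ring))⟩

/-- The linear map `s' → s` underlying the adjoint of `x`. -/
def starLinear (x : SmoothOp) : SlowSeq →ₗ[ℂ] RapidSeq where
  toFun η := ⟨starFun x η.1, mem_rapid.2 fun m => by
    obtain ⟨q, hq⟩ := η.2
    obtain ⟨C, -, h⟩ := starFun_bound x q m
    exact (h η.1 hq).1⟩
  map_add' η ζ := Subtype.ext <| funext fun j => by
    obtain ⟨p, hp⟩ := η.2
    obtain ⟨q, hq⟩ := ζ.2
    have h1 := (pairing (mem_rapid.1 (x.toCLM (unitVec j)).2 p) hp).1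
    have h2 := (pairing (mem_rapid.1 (x.toCLM (unitVec j)).2 q) hq).1
    refine Eq.trans (tsum_congr fun k => ?_) (h1.tsum_add h2)
    exact add_mul _ _ _
  map_smul' c η := Subtype.ext <| funext fun j => by
    refine Eq.trans (tsum_congr fun k => ?_) tsum_mul_left
    exact mul_assoc _ _ _

/-- The involution of `L(s', s)`: the restriction of the Hilbert space adjoint. -/
instance : Star SmoothOp :=
  ⟨fun x => ⟨starLinear x, continuous_of_bound _ fun q r => by
    obtain ⟨C, -, h⟩ := starFun_bound x q r
    exact ⟨C, fun ξ hξ => (h ξ.1 hξ).2⟩⟩⟩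

theorem toL2_star (x : SmoothOp) : toL2 (star x) = ContinuousLinearMap.adjoint (toL2 x) := by
  refine ContinuousLinearMap.ext fun f => lp.ext (funext fun j => ?_)
  have h1 := lp.inner_single_left (𝕜 := ℂ) j (1 : ℂ) (ContinuousLinearMap.adjoint (toL2 x) f)
  rw [ContinuousLinearMap.adjoint_inner_right] at h1
  have h2 := (lp.hasSum_inner (𝕜 := ℂ) (toL2 x (lp.single 2 j 1)) f).tsum_eq
  rw [h1] at h2
  simp only [RCLike.inner_apply, map_one, mul_one] at h2
  exact h2

theorem toL2_injective : Function.Injective toL2 := by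
  intro x y hxy
  refine SmoothOp.ext fun ξ => ?_
  obtain ⟨q, hq⟩ := ξ.2
  obtain ⟨C, hC, h⟩ := bound_of_continuous (x.toCLM - y.toCLM) q 0
  set z := x.toCLM - y.toCLM with hz
  have hz0 : ∀ f : L2, z (l2ToSlow f) = 0 := fun f => by
    have := congrArg Subtype.val (DFunLike.congr_fun hxy f)
    exact sub_eq_zero.2 (Subtype.ext this)
  let g : L2 := ⟨scale (-q) ξ.1, mem_weighted.1 hq⟩
  have hbound : ∀ N, wnorm 0 (z ξ).1 ≤ C * ‖g - ∑ j ∈ Finset.range N, lp.single 2 j (g j)‖ := by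
    intro N
    let t : L2 := ∑ j ∈ Finset.range N, lp.single 2 j (ξ.1 j)
    have hw : (ξ - l2ToSlow t).1 ∈ weighted (-q) :=
      sub_mem hq (weighted_mono (by omega) (mem_weighted_zero.2 t.2))
    have h1 := h _ hw
    rw [map_sub, hz0, sub_zero, wnorm_eq hw] at h1
    refine h1.trans (le_of_eq ?_)
    congr 2
    refine Subtype.ext (funext fun k => ?_)
    have e1 : t k = if k < N then ξ.1 k else 0 := by
      simp only [t, lp.coeFn_sum, Finset.sum_apply, lp.single_apply]
      simp [Pi.single_apply]
    have e2 : (∑ j ∈ Finset.range N, lp.single 2 j (g j) : L2) k = if k < N then g k else 0 := by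
      simp only [lp.coeFn_sum, Finset.sum_apply, lp.single_apply]
      simp [Pi.single_apply]
    show scale (-q) (ξ.1 - (t : ℕ → ℂ)) k = g k - (∑ j ∈ Finset.range N, lp.single 2 j (g j) : L2) k
    rw [e2]
    simp only [scale, Pi.sub_apply, e1]
    split_ifs with hk
    · rw [sub_self, sub_self, mul_zero]
    · rw [sub_zero, sub_zero]; rfl
  have hlim : Tendsto (fun N => C * ‖g - ∑ j ∈ Finset.range N, lp.single 2 j (g j)‖) atTop (𝓝 0) := by
    have := (lp.hasSum_single (by norm_num) g).tendsto_sum_nat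
    simpa using ((tendsto_const_nhds (x := g)).sub this).norm.const_mul C
  have h0 : wnorm 0 (z ξ).1 ≤ 0 := ge_of_tendsto' hlim hbound
  have : z ξ = 0 := by
    refine Subtype.ext (funext fun j => ?_)
    have := norm_mul_le_wnorm (mem_rapid.1 (z ξ).2 0) j
    simp only [Nat.cast_zero, zpow_zero, mul_one] at this
    exact norm_le_zero_iff.1 (this.trans h0)
  exact sub_eq_zero.1 this

instance : StarRing SmoothOp where
  star_involutive x := toL2_injective (by simp [toL2_star])
  star_mul x y := toL2_injective (by
    simp [toL2_star, toL2_mul, ContinuousLinearMap.adjoint_comp])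
  star_add x y := toL2_injective (by simp [toL2_star, toL2_add])

instance : StarModule ℂ SmoothOp :=
  ⟨fun c x => toL2_injective (by
    simp only [toL2_star, toL2_smul, map_smulₛₗ]; rfl)⟩

/-! ### Schauder bases -/

section SchauderBasis

variable {ι E : Type*} [AddCommGroup E] [Module ℂ E] [TopologicalSpace E]

/-- For a family `b` enumerated by an injection `ν : ι ↪ ℕ` (so `ι` is countable, possibly finite or
empty), the series `∑ c i • b i`, with its terms taken in the order given by `ν`, converges
to `x`. -/
def SeriesConvergesTo (b : ι → E) (ν : ι ↪ ℕ) (c : ι → ℂ) (x : E) : Prop :=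
  Tendsto (fun n : ℕ => ∑ i ∈ (Finset.range n).preimage ν ν.injective.injOn, c i • b i) atTop (𝓝 x)

/-- `f` is the `i`-th coefficient functional: it maps each `x` to the `i`-th coefficient of the
expansion of `x`. -/
def IsCoeffFunctional (b : ι → E) (ν : ι ↪ ℕ) (i : ι) (f : E → ℂ) : Prop :=
  ∀ (x : E) (c : ι → ℂ), SeriesConvergesTo b ν c x → f x = c i

/-- The family `b`, enumerated by `ν`, is a Schauder basis: every element has a unique expansion,
and the coefficients depend continuously on the element. -/
structure IsSchauderBasis (b : ι → E) (ν : ι ↪ ℕ) : Prop where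
  existsUnique_expansion : ∀ x : E, ∃! c : ι → ℂ, SeriesConvergesTo b ν c x
  continuous_coeff : ∀ (i : ι) (f : E → ℂ), IsCoeffFunctional b ν i f → Continuous f

end SchauderBasis

/-! ### The canonical basis of a subalgebra -/

/-- The nonzero projections in `A`: the nonzero elements whose operator on `ℓ²` is an orthogonal
projection. -/
def projections (A : NonUnitalStarSubalgebra ℂ SmoothOp) : Set A :=
  {P | P ≠ 0 ∧ IsStarProjection (toL2 P)}

/-- The set of the nonzero projections in `A` that are minimal for the order
`Q ≼ P ↔ Q * P = P * Q = Q`. -/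
def minimalProjections (A : NonUnitalStarSubalgebra ℂ SmoothOp) : Set A :=
  {P | P ∈ projections A ∧ ∀ Q ∈ projections A, Q * P = Q → P * Q = Q → Q = P}

end

end SmoothOps

namespace SmoothOps

noncomputable section

/-! Elements of `L(s', s)` act on `ℓ²` as compact operators with rapidly decreasing matrices, and
strong convergence on `ℓ²` under a common domination is already convergence in `L(s', s)`
(`tendsto_zero_of_dominated`). Hence `y R_n z → y R z` in `L(s', s)` for bounded, strongly
convergent `R_n` (`tendsto_sandwich`).

For self-adjoint `y ∈ A` and `l ≠ 0`, the mean ergodic theorem exhibits the projection onto `ker (y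
- l)` as a strong limit of polynomials in `y`. Sandwiched between two copies of `y`, this limit
stays in the closed algebra `A`, so `A` contains the eigenprojections of its self-adjoint elements
(`exists_eigenprojection`).

Projections in `A` have finite rank, hence are sums of minimal ones. By commutativity distinct
minimal projections are orthogonal, and `x P = c_P(x) P` for minimal `P`, since an eigenprojection
of `x P` cannot lie strictly below `P`. The spectral theorem gives strong convergence of the partial
sums `∑ c_P(x) P = (∑ P) x` to `x`, and domination upgrades it to convergence in `A`.

A character `φ` vanishing on all minimal projections would take the value `1` at elements of small
`ℓ²`-norm, which a Neumann series excludes. If `φ(P) ≠ 0`, applying `φ` to `x P = c_P(x) P` gives `φ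
= c_P`. -/

/-! ### Matrix entries and convergence in `L(s', s)`. -/

theorem toL2_sub (x y : SmoothOp) : toL2 (x - y) = toL2 x - toL2 y := rfl

theorem toL2_zero : toL2 0 = 0 := rfl

/-- `toL2` as a linear map. -/
def toL2Linear : SmoothOp →ₗ[ℂ] L2 →L[ℂ] L2 where
  toFun := toL2
  map_add' := toL2_add
  map_smul' := toL2_smul

/-- The `j`-th unit vector of `ℓ²`. -/
abbrev basisVec (j : ℕ) : L2 := lp.single 2 j 1

theorem toL2_star_basisVec_apply (z : SmoothOp) (i k : ℕ) :
    toL2 (star z) (basisVec i) k = star (toL2 z (basisVec k) i) := by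
  have h1 := lp.inner_single_left (𝕜 := ℂ) k (1 : ℂ) (toL2 (star z) (basisVec i))
  have h2 := lp.inner_single_right (𝕜 := ℂ) i (1 : ℂ) (toL2 z (basisVec k))
  rw [toL2_star, ContinuousLinearMap.adjoint_inner_right] at h1
  rw [h1] at h2
  rw [toL2_star]
  simpa using h2

theorem norm_toL2_apply_le_wnorm (x : SmoothOp) (f : L2) (q : ℕ) (i : ℕ) :
    ‖toL2 x f i‖ ≤ wnorm q (x.toCLM (l2ToSlow f)).1 * ((i : ℝ) + 1) ^ (-(q : ℤ)) := by
  have h := norm_mul_le_wnorm (mem_rapid.1 (x.toCLM (l2ToSlow f)).2 q) i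
  rw [zpow_neg, ← div_eq_mul_inv, le_div_iff₀ (by positivity)]
  exact h

/-- The extra power of each index beyond `q` makes the weighted square sums converge. Bounding the
columns of `star z` costs one factor `√S`, pairing them with `ξ` bounds the coordinates of `z ξ`,
and summing these costs the other. -/
theorem opNorm_le_of_entries (q : ℕ) (z : SmoothOp) {B : ℝ} (hB : 0 ≤ B)
    (h : ∀ i j : ℕ, ‖toL2 z (basisVec j) i‖ ≤
      B * ((i : ℝ) + 1) ^ (-((q : ℤ) + 1)) * ((j : ℝ) + 1) ^ (-((q : ℤ) + 1))) :
    SmoothOp.opNorm q z ≤ B * (∑' j : ℕ, ((j : ℝ) + 1) ^ (-2 : ℤ)) := by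
  set S := ∑' j : ℕ, ((j : ℝ) + 1) ^ (-2 : ℤ) with hS
  have hS0 : 0 ≤ S := tsum_nonneg fun j => by positivity
  refine ciSup_le fun ξ => ?_
  have hcol : ∀ i : ℕ, wnorm q ((star z).toCLM (unitVec i)).1 ≤
      B * ((i : ℝ) + 1) ^ (-((q : ℤ) + 1)) * Real.sqrt S := fun i => by
    refine (weighted_of_bound (m := q) (by positivity) fun k => ?_).2
    have := h i k
    rw [← norm_star, ← toL2_star_basisVec_apply] at this
    exact this
  have hrow : ∀ i : ℕ, ‖(z.toCLM ξ.1).1 i‖ ≤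
      (B * Real.sqrt S) * ((i : ℝ) + 1) ^ (-((q : ℤ) + 1)) := fun i => by
    have h1 := (pairing (mem_rapid.1 ((star z).toCLM (unitVec i)).2 q) ξ.2.1).2
    have h2 : (z.toCLM ξ.1).1 i = starFun (star z) ξ.1.1 i := by
      conv_lhs => rw [← star_star z]
      rfl
    rw [h2]
    calc _ ≤ _ := h1
      _ ≤ 1 * (B * ((i : ℝ) + 1) ^ (-((q : ℤ) + 1)) * Real.sqrt S) :=
        mul_le_mul ξ.2.2 (hcol i) (wnorm_nonneg _ _) zero_le_one
      _ = _ := by ring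
  have := (weighted_of_bound (m := q) (by positivity) hrow).2
  rwa [mul_assoc, Real.mul_self_sqrt hS0] at this

theorem exists_norm_toL2_basisVec_le (w : SmoothOp) (r : ℕ) : ∃ C : ℝ, 0 ≤ C ∧
    ∀ j : ℕ, ‖toL2 w (basisVec j)‖ ≤ C * ((j : ℝ) + 1) ^ (-(r : ℤ)) := by
  obtain ⟨C, hC, h⟩ := bound_of_continuous w.toCLM r 0
  refine ⟨C, hC, fun j => ?_⟩
  have h1 := h (unitVec j) (wnorm_unitVec _ j).1
  rw [(wnorm_unitVec _ j).2] at h1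
  rw [← wnorm_zero_eq]
  exact h1

/-- The geometric mean of the two bounds: decay in each index separately becomes joint decay at half
the exponent. -/
theorem le_of_le_of_le_zpow {t C a b : ℝ} {m : ℕ} (ht : 0 ≤ t) (hC : 0 ≤ C) (ha : 0 < a)
    (hb : 0 < b) (h1 : t ≤ C * a ^ (-((2 * m : ℕ) : ℤ))) (h2 : t ≤ C * b ^ (-((2 * m : ℕ) : ℤ))) :
    t ≤ C * a ^ (-(m : ℤ)) * b ^ (-(m : ℤ)) := by
  refine abs_le_of_sq_le_sq' ?_ (by positivity) |>.2
  calc t ^ 2 = t * t := sq t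
    _ ≤ (C * a ^ (-((2 * m : ℕ) : ℤ))) * (C * b ^ (-((2 * m : ℕ) : ℤ))) := by gcongr
    _ = _ := by
      simp only [zpow_neg, zpow_natCast, pow_mul']
      ring

/-- Dominated convergence in `L(s', s)`. -/
theorem tendsto_zero_of_dominated (z : ℕ → SmoothOp) (w w' : SmoothOp)
    (hw : ∀ n j, ‖toL2 (z n) (basisVec j)‖ ≤ ‖toL2 w (basisVec j)‖)
    (hw' : ∀ n j, ‖toL2 (star (z n)) (basisVec j)‖ ≤ ‖toL2 w' (basisVec j)‖)
    (hz : ∀ v, Tendsto (fun n => toL2 (z n) v) atTop (𝓝 0)) :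
    Tendsto z atTop (𝓝 0) := by
  rw [SmoothOp.withSeminorms.tendsto_nhds_atTop]
  intro q ε hε
  set S := ∑' j : ℕ, ((j : ℝ) + 1) ^ (-2 : ℤ) with hS
  have hS0 : 0 ≤ S := tsum_nonneg fun j => by positivity
  -- `S + 1` keeps the denominator positive, and the factor `1 / 2` leaves room for the strict
  -- inequality.
  set δ := ε / (S + 1) / 2 with hδ
  have hδ0 : 0 < δ := by positivity
  -- Halving `2 * (q + 2)` leaves `q + 2` for each index, one more than `opNorm_le_of_entries`
  -- needs. The spare factor `(i + 1)⁻¹ (j + 1)⁻¹` makes the entries small outside a finite block.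
  obtain ⟨C, hC, h1⟩ := exists_norm_toL2_basisVec_le w (2 * (q + 2))
  obtain ⟨C', hC', h2⟩ := exists_norm_toL2_basisVec_le w' (2 * (q + 2))
  set D := max C C' with hD
  have hD0 : 0 ≤ D := hC.trans (le_max_left _ _)
  have hent : ∀ n i j, ‖toL2 (z n) (basisVec j) i‖ ≤
      D * ((i : ℝ) + 1) ^ (-((q + 2 : ℕ) : ℤ)) * ((j : ℝ) + 1) ^ (-((q + 2 : ℕ) : ℤ)) := by
    intro n i j
    refine le_of_le_of_le_zpow (norm_nonneg _) hD0 (by positivity) (by positivity) ?_ ?_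
    · rw [← norm_star, ← toL2_star_basisVec_apply]
      calc _ ≤ _ := lp.norm_apply_le_norm (by norm_num) _ _
        _ ≤ _ := hw' n i
        _ ≤ _ := h2 i
        _ ≤ _ := by gcongr; exact le_max_right _ _
    · calc _ ≤ _ := lp.norm_apply_le_norm (by norm_num) _ _
        _ ≤ _ := hw n j
        _ ≤ _ := h1 j
        _ ≤ _ := by gcongr; exact le_max_left _ _
  -- Outside the block `i, j < K` one has `(i + 1) (j + 1) ≥ K`, so domination suffices there.
  -- Inside it, strong convergence handles finitely many entries.
  obtain ⟨K, hK⟩ := exists_nat_ge (D / δ)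
  have hDK : D ≤ δ * K := by rwa [div_le_iff₀' hδ0] at hK
  have hfin : ∀ᶠ n in atTop, ∀ i < K, ∀ j < K, ‖toL2 (z n) (basisVec j) i‖ ≤
      δ * ((i : ℝ) + 1) ^ (-((q : ℤ) + 1)) * ((j : ℝ) + 1) ^ (-((q : ℤ) + 1)) := by
    have : ∀ i ∈ Finset.range K, ∀ᶠ n in atTop, ∀ j ∈ Finset.range K,
        ‖toL2 (z n) (basisVec j) i‖ ≤
        δ * ((i : ℝ) + 1) ^ (-((q : ℤ) + 1)) * ((j : ℝ) + 1) ^ (-((q : ℤ) + 1)) := by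
      intro i _
      rw [Filter.eventually_all_finset]
      intro j _
      have h3 := (hz (basisVec j)).norm
      rw [norm_zero] at h3
      filter_upwards [h3.eventually_le_const (show 0 < δ * ((i : ℝ) + 1) ^ (-((q : ℤ) + 1)) *
        ((j : ℝ) + 1) ^ (-((q : ℤ) + 1)) by positivity)] with n hn
      exact (lp.norm_apply_le_norm (by norm_num) _ _).trans hn
    rw [← Filter.eventually_all_finset] at this
    filter_upwards [this] with n hn i hi j hj
    exact hn i (Finset.mem_range.2 hi) j (Finset.mem_range.2 hj)
  obtain ⟨N, hN⟩ := eventually_atTop.1 hfin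
  refine ⟨N, fun n hn => ?_⟩
  rw [sub_zero]
  have key : SmoothOp.opNorm q (z n) ≤ δ * S := by
    refine opNorm_le_of_entries q _ hδ0.le fun i j => ?_
    by_cases hij : i < K ∧ j < K
    · exact hN n hn i hij.1 j hij.2
    have hp : ∀ k : ℕ, ((k : ℝ) + 1) ^ (-((q + 2 : ℕ) : ℤ)) =
        ((k : ℝ) + 1) ^ (-((q : ℤ) + 1)) * ((k : ℝ) + 1)⁻¹ := fun k => by
      rw [← zpow_neg_one, ← zpow_add₀ (by positivity)]
      congr 1
    refine (hent n i j).trans ?_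
    rw [hp, hp]
    have hsmall : D * (((i : ℝ) + 1)⁻¹ * ((j : ℝ) + 1)⁻¹) ≤ δ := by
      rw [← mul_inv, ← div_eq_mul_inv, div_le_iff₀ (by positivity)]
      refine hDK.trans (mul_le_mul_of_nonneg_left ?_ hδ0.le)
      have hi : (0 : ℝ) ≤ i := by positivity
      have hj : (0 : ℝ) ≤ j := by positivity
      rcases not_and_or.1 hij with h | h
      · have : (K : ℝ) ≤ i := by exact_mod_cast not_lt.1 h
        nlinarith
      · have : (K : ℝ) ≤ j := by exact_mod_cast not_lt.1 h
        nlinarith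
    calc _ = D * (((i : ℝ) + 1)⁻¹ * ((j : ℝ) + 1)⁻¹) * ((i : ℝ) + 1) ^ (-((q : ℤ) + 1)) *
        ((j : ℝ) + 1) ^ (-((q : ℤ) + 1)) := by ring
      _ ≤ _ := by gcongr
  refine lt_of_le_of_lt key ?_
  have : δ * (S + 1) = ε / 2 := by rw [hδ]; field_simp
  nlinarith

theorem continuous_toL2 : Continuous toL2 := by
  refine continuous_of_continuousAt_zero toL2Linear.toAddMonoidHom ?_
  show Tendsto toL2 (𝓝 0) (𝓝 (toL2 0))
  rw [toL2_zero, tendsto_zero_iff_norm_tendsto_zero]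
  have h := (SmoothOp.withSeminorms.continuous_seminorm 0).tendsto 0
  rw [map_zero] at h
  refine squeeze_zero (fun _ => norm_nonneg _) (fun x => ?_) h
  refine ContinuousLinearMap.opNorm_le_of_unit_norm (apply_nonneg _ _) fun f hf => ?_
  have hmem : l2ToSlow f ∈ dualBall 0 := by
    rw [dualBall, Nat.cast_zero, neg_zero]
    exact ⟨mem_weighted_zero.2 f.2, ((wnorm_zero_eq f).trans hf).le⟩
  rw [toL2_apply, ← wnorm_zero_eq]
  exact le_ciSup (x.bddAbove 0) ⟨l2ToSlow f, hmem⟩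

/-! ### Bounded operators on `ℓ²` between two elements of `L(s', s)`. -/

/-- The operator `y R z` of `L(s', s)`, for an operator `R` on `ℓ²`. -/
def sandwich (y : SmoothOp) (R : L2 →L[ℂ] L2) (z : SmoothOp) : SmoothOp :=
  ⟨y.toCLM.toLinearMap ∘ₗ l2ToSlow ∘ₗ R.toLinearMap ∘ₗ rapidToL2 ∘ₗ z.toCLM.toLinearMap,
    continuous_of_bound _ fun q r => by
      obtain ⟨C, hC, h⟩ := bound_of_continuous z.toCLM q 0
      obtain ⟨D, hD, h'⟩ := bound_of_continuous y.toCLM 0 r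
      refine ⟨D * (‖R‖ * C), fun ξ hξ => ?_⟩
      have h1 := h ξ hξ
      have h2 := h' (l2ToSlow (R (rapidToL2 (z.toCLM ξ)))) (by
        rw [Nat.cast_zero, neg_zero]; exact mem_weighted_zero.2 (R (rapidToL2 (z.toCLM ξ))).2)
      have h3 : wnorm 0 (l2ToSlow (R (rapidToL2 (z.toCLM ξ)))).1
          ≤ ‖R‖ * wnorm 0 (z.toCLM ξ).1 :=
        calc _ = _ := wnorm_zero_eq _
          _ ≤ _ := R.le_opNorm _
          _ = _ := by rw [← wnorm_zero_eq]; rfl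
      rw [Nat.cast_zero, neg_zero] at h2
      calc _ ≤ _ := h2
        _ ≤ D * (‖R‖ * (C * wnorm (-q) ξ.1)) := by
          gcongr
          exact h3.trans (by gcongr; exact h1)
        _ = _ := by ring⟩

theorem toL2_sandwich (y : SmoothOp) (R : L2 →L[ℂ] L2) (z : SmoothOp) :
    toL2 (sandwich y R z) = toL2 y ∘L R ∘L toL2 z := rfl

/-- A bounded sequence of operators on `ℓ²` that converges strongly converges in `L(s', s)` after
multiplication by elements of `L(s', s)` from both sides. -/
theorem tendsto_sandwich (y z : SmoothOp) (R : ℕ → L2 →L[ℂ] L2) (R₀ : L2 →L[ℂ] L2) (M : ℝ)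
    (hM : ∀ n, ‖R n‖ ≤ M) (hR : ∀ v, Tendsto (fun n => R n v) atTop (𝓝 (R₀ v))) :
    Tendsto (fun n => sandwich y (R n) z) atTop (𝓝 (sandwich y R₀ z)) := by
  rw [← tendsto_sub_nhds_zero_iff]
  have hM0 : 0 ≤ M := (norm_nonneg _).trans (hM 0)
  have hb : ∀ n, ‖R n - R₀‖ ≤ M + ‖R₀‖ := fun n => (norm_sub_le _ _).trans (by gcongr; exact hM n)
  have e : ∀ n, toL2 (sandwich y (R n) z - sandwich y R₀ z) =
      toL2 y ∘L (R n - R₀) ∘L toL2 z := fun n => by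
    rw [toL2_sub, toL2_sandwich, toL2_sandwich]
    ext v : 1
    simp
  -- The columns of `y (R n - R₀) z` are dominated by those of a multiple of `z`, and the columns of
  -- the adjoint by those of a multiple of `star y`.
  refine tendsto_zero_of_dominated _ (((‖toL2 y‖ * (M + ‖R₀‖) : ℝ) : ℂ) • z)
    (((‖toL2 z‖ * (M + ‖R₀‖) : ℝ) : ℂ) • star y) (fun n j => ?_) (fun n j => ?_) (fun v => ?_)
  · rw [e, toL2_smul, smul_apply, norm_smul, Complex.norm_real,
      Real.norm_of_nonneg (by positivity)]
    calc _ ≤ ‖toL2 y‖ * ‖(R n - R₀) (toL2 z (basisVec j))‖ := ContinuousLinearMap.le_opNorm _ _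
      _ ≤ ‖toL2 y‖ * ((M + ‖R₀‖) * ‖toL2 z (basisVec j)‖) := by
        gcongr
        exact ContinuousLinearMap.le_of_opNorm_le _ (hb n) _
      _ = _ := by ring
  · rw [toL2_star, e, toL2_smul, smul_apply, norm_smul, Complex.norm_real,
      Real.norm_of_nonneg (by positivity), ContinuousLinearMap.adjoint_comp,
      ContinuousLinearMap.adjoint_comp, toL2_star]
    calc _ ≤ ‖ContinuousLinearMap.adjoint (toL2 z)‖ * ‖ContinuousLinearMap.adjoint (R n - R₀)
          (ContinuousLinearMap.adjoint (toL2 y) (basisVec j))‖ :=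
          ContinuousLinearMap.le_opNorm _ _
      _ ≤ ‖toL2 z‖ * ((M + ‖R₀‖) * ‖ContinuousLinearMap.adjoint (toL2 y) (basisVec j)‖) := by
        rw [LinearIsometryEquiv.norm_map]
        gcongr
        exact ContinuousLinearMap.le_of_opNorm_le _
          ((LinearIsometryEquiv.norm_map _ _).trans_le (hb n)) _
      _ = _ := by ring
  · simp only [e]
    have := (toL2 y).continuous.tendsto 0 |>.comp
      (tendsto_sub_nhds_zero_iff.2 (hR (toL2 z v)))
    rw [map_zero] at this
    exact this

/-- The `i`-th coordinate of `x f` is `O((i + 1)⁻²) ‖f‖`, because `x` is bounded into the norm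
`|·|_2`. So `x` is a norm-convergent sum of its rank-at-most-one rows `R i`. -/
theorem isCompactOperator_toL2 (x : SmoothOp) : IsCompactOperator (toL2 x) := by
  obtain ⟨C, hC, h⟩ := bound_of_continuous x.toCLM 0 2
  let R : ℕ → L2 →L[ℂ] L2 := fun i =>
    (((innerSL ℂ (basisVec i)).comp (toL2 x)).smulRight (basisVec i))
  have hRv : ∀ i f, R i f = lp.single 2 i (toL2 x f i) := fun i f => by
    have h1 := lp.inner_single_left (𝕜 := ℂ) i (1 : ℂ) (toL2 x f)
    simp only [RCLike.inner_apply, map_one, mul_one] at h1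
    rw [ContinuousLinearMap.smulRight_apply, ContinuousLinearMap.comp_apply, innerSL_apply_apply, h1,
      ← lp.single_smul, smul_eq_mul, mul_one]
  have hRn : ∀ i, ‖R i‖ ≤ C * ((i : ℝ) + 1) ^ (-2 : ℤ) := fun i => by
    refine ContinuousLinearMap.opNorm_le_bound _ (by positivity) fun f => ?_
    rw [hRv, lp.norm_single (by norm_num)]
    have h2 := h (l2ToSlow f) (by
      rw [Nat.cast_zero, neg_zero]; exact mem_weighted_zero.2 f.2)
    rw [Nat.cast_zero, neg_zero] at h2
    have h3 : wnorm 0 (l2ToSlow f).1 = ‖f‖ := wnorm_zero_eq f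
    rw [h3] at h2
    refine (norm_toL2_apply_le_wnorm x f 2 i).trans ?_
    calc _ ≤ (C * ‖f‖) * ((i : ℝ) + 1) ^ (-2 : ℤ) :=
        mul_le_mul_of_nonneg_right h2 (by positivity)
      _ = _ := by ring
  have hsum : Summable R := .of_norm_bounded (summable_inv_sq.mul_left C) hRn
  have hx : HasSum R (toL2 x) := by
    convert hsum.hasSum
    refine ContinuousLinearMap.ext fun f => ?_
    have h1 := hsum.hasSum.mapL (ContinuousLinearMap.apply ℂ L2 f)
    have h2 := lp.hasSum_single (p := 2) (by norm_num) (toL2 x f)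
    simp only [← hRv] at h2
    exact h2.unique h1
  refine isCompactOperator_of_tendsto hx (Eventually.of_forall fun s => ?_)
  have : ∀ i ∈ s, R i ∈ compactOperator (RingHom.id ℂ) L2 L2 := fun i _ =>
    (isCompactOperator_of_locallyCompactSpace_dom
      ((innerSL ℂ (basisVec i)).comp (toL2 x))).clm_comp
      (ContinuousLinearMap.toSpanSingleton ℂ (basisVec i))
  exact Submodule.sum_mem _ this

theorem isStarProjection_toL2_iff {P : SmoothOp} :
    IsStarProjection (toL2 P) ↔ IsStarProjection P := by
  have h1 : toL2 P * toL2 P = toL2 (P * P) := rfl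
  have h2 : star (toL2 P) = toL2 (star P) := (toL2_star P).symm
  rw [isStarProjection_iff', isStarProjection_iff', h1, h2, toL2_injective.eq_iff,
    toL2_injective.eq_iff]

/-! ### Multipliers and limits in the closed algebra `A`. -/

/-- The operators `R` on `ℓ²` with `a R ∈ A` for all `a ∈ A`. -/
def multipliers (A : NonUnitalStarSubalgebra ℂ SmoothOp) : Subalgebra ℂ (L2 →L[ℂ] L2) where
  carrier := {R | ∀ a ∈ A, ∃ b ∈ A, toL2 b = toL2 a * R}
  mul_mem' {R S} hR hS a ha := by
    obtain ⟨b, hb, h1⟩ := hR a ha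
    obtain ⟨c, hc, h2⟩ := hS b hb
    exact ⟨c, hc, by rw [h2, h1, mul_assoc]⟩
  add_mem' {R S} hR hS a ha := by
    obtain ⟨b, hb, h1⟩ := hR a ha
    obtain ⟨c, hc, h2⟩ := hS a ha
    exact ⟨b + c, add_mem hb hc, by rw [toL2_add, h2, h1, mul_add]⟩
  algebraMap_mem' r a ha := ⟨r • a, SMulMemClass.smul_mem r ha, by
    rw [toL2_smul, Algebra.algebraMap_eq_smul_one, mul_smul_comm, mul_one]⟩

variable {A : NonUnitalStarSubalgebra ℂ SmoothOp}

theorem toL2_mem_multipliers {x : SmoothOp} (hx : x ∈ A) : toL2 x ∈ multipliers A :=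
  fun a ha => ⟨a * x, mul_mem ha hx, rfl⟩

/-- Multipliers provide polynomials with a constant term although `A` may lack a unit. Each `(y R_n)
z` lies in `A`, and closedness passes this to the limit. -/
theorem sandwich_mem_of_tendsto (hA : IsClosed (A : Set SmoothOp)) {y z : SmoothOp} (hy : y ∈ A)
    (hz : z ∈ A) {R : ℕ → L2 →L[ℂ] L2} {R₀ : L2 →L[ℂ] L2} {M : ℝ}
    (hmem : ∀ n, R n ∈ multipliers A) (hM : ∀ n, ‖R n‖ ≤ M)
    (hR : ∀ v, Tendsto (fun n => R n v) atTop (𝓝 (R₀ v))) : sandwich y R₀ z ∈ A := by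
  refine hA.mem_of_tendsto (tendsto_sandwich y z R R₀ M hM hR) (Eventually.of_forall fun n => ?_)
  obtain ⟨b, hb, h⟩ := hmem n y hy
  have : sandwich y (R n) z = b * z := toL2_injective (by
    rw [toL2_sandwich, toL2_mul, h]; rfl)
  rw [this]
  exact mul_mem hb hz

/-! ### Kernels of self-adjoint operators through the mean ergodic theorem. -/

section Contraction

variable {E : Type*} [NormedAddCommGroup E] [InnerProductSpace ℂ E] [CompleteSpace E]

theorem norm_apply_sq_eq_re_inner {C : E →L[ℂ] E} (hC : IsSelfAdjoint C) (v : E) :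
    ‖C v‖ ^ 2 = (inner ℂ (C (C v)) v).re := by
  have h := hC.isSymmetric (C v) v
  simp only [ContinuousLinearMap.coe_coe] at h
  rw [h]
  exact (inner_self_eq_norm_sq (𝕜 := ℂ) (C v)).symm

/-- With `c = 1 / (‖C‖² + 1)` one has `0 ≤ c C² ≤ 1`, and `‖C v‖² = ⟨C² v, v⟩` shows that `C²` and
`C` have the same kernel. The summand `1` covers `C = 0`. -/
theorem exists_contraction_fixing_ker {C : E →L[ℂ] E} (hC : IsSelfAdjoint C) :
    ∃ c : ℂ, ‖1 - c • (C * C)‖ ≤ 1 ∧ ∀ v, (1 - c • (C * C)) v = v ↔ C v = 0 := by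
  set K : ℝ := ‖C‖ ^ 2 + 1 with hK
  have hK0 : 0 < K := by positivity
  refine ⟨((K⁻¹ : ℝ) : ℂ), ContinuousLinearMap.opNorm_le_bound _ zero_le_one fun v => ?_,
    fun v => ?_⟩
  · have e : (1 - ((K⁻¹ : ℝ) : ℂ) • (C * C)) v = v - ((K⁻¹ : ℝ) : ℂ) • C (C v) := rfl
    rw [one_mul, e]
    refine abs_le_of_sq_le_sq' ?_ (norm_nonneg _) |>.2
    rw [norm_sub_sq (𝕜 := ℂ), norm_smul, Complex.norm_real, Real.norm_of_nonneg (by positivity),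
      inner_smul_right, mul_pow]
    have h1 : (inner ℂ v (C (C v))).re = ‖C v‖ ^ 2 := by
      rw [norm_apply_sq_eq_re_inner hC, ← inner_conj_symm, Complex.conj_re]
    have h2 : RCLike.re (((K⁻¹ : ℝ) : ℂ) * inner ℂ v (C (C v))) = K⁻¹ * ‖C v‖ ^ 2 := by
      rw [← h1]
      exact Complex.re_ofReal_mul _ _
    rw [h2]
    have h3 : ‖C (C v)‖ ^ 2 ≤ K * ‖C v‖ ^ 2 := by
      have := pow_le_pow_left₀ (norm_nonneg _) (C.le_opNorm (C v)) 2
      rw [mul_pow] at this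
      nlinarith [sq_nonneg ‖C v‖]
    have h4 : K⁻¹ ^ 2 * ‖C (C v)‖ ^ 2 ≤ K⁻¹ * ‖C v‖ ^ 2 := by
      calc _ ≤ K⁻¹ ^ 2 * (K * ‖C v‖ ^ 2) := by gcongr
        _ = _ := by field_simp
    have h5 : 0 ≤ K⁻¹ * ‖C v‖ ^ 2 := by positivity
    linarith
  · have e : (1 - ((K⁻¹ : ℝ) : ℂ) • (C * C)) v = v - ((K⁻¹ : ℝ) : ℂ) • C (C v) := rfl
    have hne : ((K⁻¹ : ℝ) : ℂ) ≠ 0 := by exact_mod_cast (inv_pos.2 hK0).ne'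
    rw [e, sub_eq_self, smul_eq_zero, or_iff_right hne]
    refine ⟨fun h => ?_, fun h => by rw [h, map_zero]⟩
    have := norm_apply_sq_eq_re_inner hC v
    rw [h, inner_zero_left, Complex.zero_re] at this
    simpa using this

/-- The average of the first `n` powers of an operator. -/
def powAverage (S : E →L[ℂ] E) (n : ℕ) : E →L[ℂ] E :=
  (n : ℂ)⁻¹ • ∑ k ∈ Finset.range n, S ^ k

theorem norm_powAverage_le {S : E →L[ℂ] E} (hS : ‖S‖ ≤ 1) (n : ℕ) : ‖powAverage S n‖ ≤ 1 := by
  have hpow : ∀ k, ‖S ^ k‖ ≤ 1 := fun k => by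
    induction k with
    | zero => exact ContinuousLinearMap.norm_id_le
    | succ k ih =>
      rw [pow_succ]
      exact (norm_mul_le _ _).trans (mul_le_one₀ ih (norm_nonneg _) hS)
  rw [powAverage, norm_smul, norm_inv, Complex.norm_natCast]
  rcases Nat.eq_zero_or_pos n with rfl | hn
  · simp
  · rw [inv_mul_le_iff₀ (by exact_mod_cast hn), mul_one]
    refine (norm_sum_le _ _).trans ((Finset.sum_le_sum fun k _ => hpow k).trans ?_)
    simp

theorem tendsto_powAverage {S : E →L[ℂ] E} (hS : ‖S‖ ≤ 1) (v : E) :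
    Tendsto (fun n => powAverage S n v) atTop
      (𝓝 ((S.eqLocus (1 : E →L[ℂ] E)).starProjection v)) := by
  refine (S.tendsto_birkhoffAverage_orthogonalProjection hS v).congr fun n => ?_
  simp [powAverage, birkhoffAverage, birkhoffSum]

end Contraction

/-! ### Eigenprojections of self-adjoint elements of `A`. -/

theorem powAverage_mem_multipliers {S : L2 →L[ℂ] L2} (hS : S ∈ multipliers A) (n : ℕ) :
    powAverage S n ∈ multipliers A :=
  Subalgebra.smul_mem _ (sum_mem fun _ _ => pow_mem hS _) _

/-- The projection `p` onto `ker (y - l)` is the strong limit of the power averages of `1 - c (y -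
l)²`, which are multipliers of `A`. Since `y p = p y = l p`, it equals `l⁻² y p y`. This form puts
it in `A` and is where `l ≠ 0` enters. -/
theorem exists_eigenprojection (hA : IsClosed (A : Set SmoothOp)) {y : SmoothOp} (hy : y ∈ A)
    (hsa : star y = y) {l : ℝ} (hl : l ≠ 0) :
    ∃ Q ∈ A, IsStarProjection (toL2 Q) ∧ ∀ v, toL2 Q v = v ↔ toL2 y v = (l : ℂ) • v := by
  have hT : IsSelfAdjoint (toL2 y) := by
    rw [ContinuousLinearMap.isSelfAdjoint_iff', ← toL2_star, hsa]
  have hl' : (l : ℂ) ≠ 0 := by exact_mod_cast hl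
  set C : L2 →L[ℂ] L2 := toL2 y - algebraMap ℂ _ (l : ℂ) with hCdef
  have hCv : ∀ v, C v = toL2 y v - (l : ℂ) • v := fun v => rfl
  have hC : IsSelfAdjoint C := by
    refine hT.sub ?_
    rw [Algebra.algebraMap_eq_smul_one, IsSelfAdjoint, star_smul, star_one]
    simp
  obtain ⟨c, hS, hfix⟩ := exists_contraction_fixing_ker hC
  set S := 1 - c • (C * C) with hSdef
  have hCm : C ∈ multipliers A := sub_mem (toL2_mem_multipliers hy) (Subalgebra.algebraMap_mem _ _)
  have hSm : S ∈ multipliers A :=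
    sub_mem (one_mem _) (Subalgebra.smul_mem _ (mul_mem hCm hCm) _)
  set U := S.eqLocus (1 : L2 →L[ℂ] L2) with hU
  have hmemU : ∀ v, v ∈ U ↔ toL2 y v = (l : ℂ) • v := fun v => by
    rw [← sub_eq_zero, ← hCv, ← hfix]
    rfl
  have hPr : IsSelfAdjoint U.starProjection := isSelfAdjoint_starProjection U
  have h1 : toL2 y * U.starProjection = (l : ℂ) • U.starProjection :=
    ContinuousLinearMap.ext fun v => (hmemU _).1 (U.starProjection_apply_mem v)
  have h2 : U.starProjection * toL2 y = (l : ℂ) • U.starProjection := by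
    have := congrArg star h1
    rw [star_mul, hPr.star_eq, hT.star_eq, star_smul, hPr.star_eq] at this
    simpa using this
  have hQ : toL2 ((((l : ℂ)⁻¹) ^ 2) • sandwich y U.starProjection y) = U.starProjection := by
    rw [toL2_smul, toL2_sandwich]
    have : toL2 y ∘L U.starProjection ∘L toL2 y = toL2 y * (U.starProjection * toL2 y) := rfl
    rw [this, h2, mul_smul_comm, h1, smul_smul, smul_smul]
    rw [show ((l : ℂ)⁻¹) ^ 2 * l * l = 1 by field_simp, one_smul]
  refine ⟨_, SMulMemClass.smul_mem (((l : ℂ)⁻¹) ^ 2) (sandwich_mem_of_tendsto hA hy hy (powAverage_mem_multipliers hSm)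
    (norm_powAverage_le hS) (tendsto_powAverage hS)), ?_, fun v => ?_⟩
  · rw [hQ]
    exact isStarProjection_starProjection
  · rw [hQ, Submodule.starProjection_eq_self_iff, hmemU]

theorem exists_eigenvector {y : SmoothOp} (hsa : star y = y) (hy : y ≠ 0) :
    ∃ l : ℝ, l ≠ 0 ∧ ∃ v, v ≠ 0 ∧ toL2 y v = (l : ℂ) • v := by
  have hT : IsSelfAdjoint (toL2 y) := by
    rw [ContinuousLinearMap.isSelfAdjoint_iff', ← toL2_star, hsa]
  have h := (ContinuousLinearMap.eq_zero_of_forall_hasEigenvalue_eq_zero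
    (isCompactOperator_toL2 y) hT.isSymmetric).not.2 (fun h => hy (toL2_injective h))
  push Not at h
  obtain ⟨μ, hμ, hμ0⟩ := h
  have hre : (μ.re : ℂ) = μ := Complex.conj_eq_iff_re.1 (hT.isSymmetric.conj_eigenvalue_eq_self hμ)
  obtain ⟨v, hv⟩ := hμ.exists_hasEigenvector
  refine ⟨μ.re, fun h0 => hμ0 (by rw [← hre, h0, Complex.ofReal_zero]), v, hv.2, ?_⟩
  rw [hre]
  exact hv.apply_eq_smul

/-! ### Projections in `A` and induction on the rank. -/

theorem finiteDimensional_range_of_isStarProjection {P : SmoothOp}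
    (hP : IsStarProjection (toL2 P)) : FiniteDimensional ℂ (toL2 P).range := by
  have := ContinuousLinearMap.finite_dimensional_eigenspace (isCompactOperator_toL2 P) 1 one_ne_zero
  refine Submodule.finiteDimensional_of_le
    (S₂ := Module.End.eigenspace (toL2 P).toLinearMap 1) ?_
  rintro _ ⟨v, rfl⟩
  rw [Module.End.mem_eigenspace_iff, one_smul]
  exact DFunLike.congr_fun hP.isIdempotentElem v

theorem finrank_range_lt {R Q : SmoothOp} (hR : IsStarProjection (toL2 R))
    (hQ : IsStarProjection (toL2 Q)) (hRQ : R * Q = R) (hQR : Q * R = R) (hne : R ≠ Q) :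
    Module.finrank ℂ (toL2 R).range < Module.finrank ℂ (toL2 Q).range := by
  have := finiteDimensional_range_of_isStarProjection hQ
  refine Submodule.finrank_lt_finrank_of_lt (lt_of_le_of_ne ?_ fun h => hne ?_)
  · rintro _ ⟨v, rfl⟩
    exact ⟨toL2 R v, congrArg (fun x => toL2 x v) hQR⟩
  · rw [← hRQ]
    refine toL2_injective (ContinuousLinearMap.ext fun v => ?_)
    have hv : toL2 Q v ∈ (toL2 R).range := h ▸ ⟨v, rfl⟩
    obtain ⟨u, hu⟩ := hv
    have hu' : toL2 R u = toL2 Q v := hu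
    rw [toL2_mul, ContinuousLinearMap.comp_apply, ← hu']
    exact DFunLike.congr_fun hR.isIdempotentElem u

theorem projection_mul_self {P : A} (hP : P ∈ projections A) : P * P = P :=
  Subtype.ext (isStarProjection_toL2_iff.1 hP.2).isIdempotentElem

theorem star_projection {P : A} (hP : P ∈ projections A) : star P = P :=
  Subtype.ext (isStarProjection_toL2_iff.1 hP.2).isSelfAdjoint

theorem mem_projections_iff {P : A} : P ∈ projections A ↔ P ≠ 0 ∧ P * P = P ∧ star P = P := by
  refine ⟨fun h => ⟨h.1, projection_mul_self h, star_projection h⟩, fun h => ⟨h.1, ?_⟩⟩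
  exact isStarProjection_toL2_iff.2 ⟨congrArg Subtype.val h.2.1, congrArg Subtype.val h.2.2⟩

/-- A non-minimal `Q` has some `R ≠ Q` strictly below it, and `Q = R + (Q - R)` splits it into two
projections in `A` of smaller finite rank. -/
theorem projection_induction {p : A → Prop} (hmin : ∀ P ∈ minimalProjections A, p P)
    (hadd : ∀ P Q, p P → p Q → p (P + Q)) {Q : A} (hQ : Q ∈ projections A) : p Q := by
  induction hn : Module.finrank ℂ (toL2 Q).range using Nat.strong_induction_on generalizing Q with
  | _ n ih =>
    subst hn
    by_cases hm : Q ∈ minimalProjections A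
    · exact hmin Q hm
    have : ∃ R ∈ projections A, R * Q = R ∧ Q * R = R ∧ R ≠ Q := by
      by_contra! h
      exact hm ⟨hQ, fun R hR h1 h2 => h R hR h1 h2⟩
    obtain ⟨R, hR, hRQ, hQR, hne⟩ := this
    have hRR := projection_mul_self hR
    have hQQ := projection_mul_self hQ
    have hD : Q - R ∈ projections A := by
      refine mem_projections_iff.2 ⟨sub_ne_zero.2 hne.symm, ?_, ?_⟩
      · rw [sub_mul, mul_sub, mul_sub, hRR, hQQ, hRQ, hQR, sub_self, sub_zero]
      · rw [star_sub, star_projection hR, star_projection hQ]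
    rw [← add_sub_cancel R Q]
    refine hadd _ _ (ih _ (finrank_range_lt hR.2 hQ.2 (congrArg Subtype.val hRQ)
      (congrArg Subtype.val hQR) (Subtype.coe_injective.ne hne)) hR rfl)
      (ih _ (finrank_range_lt hD.2 hQ.2 (congrArg Subtype.val (?_ : (Q - R) * Q = Q - R))
      (congrArg Subtype.val (?_ : Q * (Q - R) = Q - R)) (Subtype.coe_injective.ne ?_)) hD rfl)
    · rw [sub_mul, hQQ, hRQ]
    · rw [mul_sub, hQQ, hQR]
    · rw [Ne, sub_eq_self]
      exact hR.1

/-! ### Orthogonality of minimal projections and the eigenvalue relation. -/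

section Commutative

variable (hcomm : ∀ x ∈ A, ∀ y ∈ A, x * y = y * x)
include hcomm

theorem mul_comm_of_forall (x y : A) : x * y = y * x := Subtype.ext (hcomm x x.2 y y.2)

/-- By commutativity `P Q` is a projection below both factors. Were it nonzero, minimality would
make it equal to both. -/
theorem mul_eq_zero_of_minimal {P Q : A} (hP : P ∈ minimalProjections A)
    (hQ : Q ∈ minimalProjections A) (hne : P ≠ Q) : P * Q = 0 := by
  have hc := mul_comm_of_forall hcomm
  have hPP := projection_mul_self hP.1
  have hQQ := projection_mul_self hQ.1
  by_contra h0
  have hPQ : P * Q ∈ projections A := by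
    refine mem_projections_iff.2 ⟨h0, ?_, ?_⟩
    · rw [mul_assoc, ← mul_assoc Q, hc Q P, mul_assoc, hQQ, ← mul_assoc, hPP]
    · rw [star_mul, star_projection hP.1, star_projection hQ.1, hc]
  have h1 : P * (P * Q) = P * Q := by rw [← mul_assoc, hPP]
  have h2 : P * Q * Q = P * Q := by rw [mul_assoc, hQQ]
  exact hne ((hP.2 _ hPQ ((hc _ _).trans h1) h1).symm.trans
    (hQ.2 _ hPQ h2 ((hc _ _).trans h2)))

variable (hA : IsClosed (A : Set SmoothOp))
include hA

/-- If `z = x P` is nonzero, it is self-adjoint with an eigenvalue `l ≠ 0`. Its eigenprojection lies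
in `A` and below `P`, hence equals `P`, so `z` acts as `l` on the whole range of `P`. -/
theorem exists_mul_minimal_eq_smul_of_star_eq {P : A} (hP : P ∈ minimalProjections A) {x : A}
    (hx : star x = x) : ∃ c : ℂ, x * P = c • P := by
  have hc := mul_comm_of_forall hcomm
  have hPP := projection_mul_self hP.1
  by_cases h0 : x * P = 0
  · exact ⟨0, by rw [h0, zero_smul]⟩
  set z := x * P with hz
  have hzP : z * P = z := by rw [hz, mul_assoc, hPP]
  have hPz : P * z = z := by rw [hc, hzP]
  have hzs : star z = z := by rw [hz, star_mul, hx, star_projection hP.1, hc]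
  have hzs' : star (z : SmoothOp) = z := congrArg Subtype.val hzs
  obtain ⟨l, hl, v, hv, hvl⟩ := exists_eigenvector hzs'
    (fun h => h0 (Subtype.ext h))
  have hl' : (l : ℂ) ≠ 0 := by exact_mod_cast hl
  obtain ⟨Q, hQA, hQ, hQv⟩ := exists_eigenprojection hA z.2 hzs' hl
  have hQm : (⟨Q, hQA⟩ : A) ∈ projections A := by
    refine ⟨fun h => hv ?_, hQ⟩
    rw [← (hQv v).2 hvl, show Q = 0 from congrArg Subtype.val h]
    rfl
  -- `z` acts as `l` on the range of `Q`, so dividing `P z Q = z Q` by `l` gives `P Q = Q`.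
  have hPQ : P * ⟨Q, hQA⟩ = ⟨Q, hQA⟩ := by
    refine Subtype.ext (toL2_injective (ContinuousLinearMap.ext fun u => ?_))
    show toL2 P (toL2 Q u) = toL2 Q u
    have h1 := (hQv (toL2 Q u)).1 (DFunLike.congr_fun hQ.isIdempotentElem u)
    have h2 : toL2 P (toL2 z (toL2 Q u)) = toL2 z (toL2 Q u) :=
      congrArg (fun y : A => toL2 y (toL2 Q u)) hPz
    rw [h1, map_smul] at h2
    exact smul_right_injective _ hl' h2
  have hQP := hP.2 _ hQm ((hc _ _).trans hPQ) hPQ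
  have hQP' : Q = P := congrArg Subtype.val hQP
  refine ⟨l, ?_⟩
  rw [← hzP]
  refine Subtype.ext (toL2_injective (ContinuousLinearMap.ext fun u => ?_))
  show toL2 z (toL2 P u) = (l : ℂ) • toL2 P u
  rw [← hQv, hQP']
  exact DFunLike.congr_fun hP.1.2.isIdempotentElem u

theorem exists_mul_minimal_eq_smul {P : A} (hP : P ∈ minimalProjections A) (x : A) :
    ∃ c : ℂ, x * P = c • P := by
  obtain ⟨a, ha⟩ := exists_mul_minimal_eq_smul_of_star_eq hcomm hA hP (realPart x).2
  obtain ⟨b, hb⟩ := exists_mul_minimal_eq_smul_of_star_eq hcomm hA hP (imaginaryPart x).2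
  refine ⟨a + Complex.I * b, ?_⟩
  conv_lhs => rw [← realPart_add_I_smul_imaginaryPart x]
  rw [add_mul, smul_mul_assoc, ha, hb, add_smul, mul_smul]

end Commutative

/-! ### The coefficient functionals. -/

theorem exists_unit_vector {P : A} (hP : P ∈ projections A) : ∃ v, ‖v‖ = 1 ∧ toL2 P v = v := by
  have : ∃ u, toL2 P u ≠ 0 := by
    by_contra! h
    exact hP.1 (Subtype.ext (toL2_injective (ContinuousLinearMap.ext h)))
  obtain ⟨u, hu⟩ := this
  refine ⟨((‖toL2 P u‖⁻¹ : ℝ) : ℂ) • toL2 P u, ?_, ?_⟩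
  · rw [norm_smul, Complex.norm_real, norm_inv, norm_norm, inv_mul_cancel₀ (norm_ne_zero_iff.2 hu)]
  · rw [map_smul]
    exact congrArg _ (DFunLike.congr_fun hP.2.isIdempotentElem u)

/-- A unit vector in the range of the minimal projection `P`. -/
def unitVector (P : minimalProjections A) : L2 := (exists_unit_vector P.2.1).choose

theorem norm_unitVector (P : minimalProjections A) : ‖unitVector P‖ = 1 :=
  (exists_unit_vector P.2.1).choose_spec.1

theorem apply_unitVector (P : minimalProjections A) : toL2 P (unitVector P) = unitVector P :=
  (exists_unit_vector P.2.1).choose_spec.2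

theorem inner_unitVector_self (P : minimalProjections A) :
    inner ℂ (unitVector P) (unitVector P) = 1 := by
  rw [inner_self_eq_norm_sq_to_K, norm_unitVector]
  simp

theorem inner_apply_eq {x : A} (hx : star x = x) (u v : L2) :
    inner ℂ (toL2 x u) v = inner ℂ u (toL2 x v) := by
  have h : star (x : SmoothOp) = x := congrArg Subtype.val hx
  rw [← ContinuousLinearMap.adjoint_inner_right, ← toL2_star, h]

/-- The coefficient of `x` at the minimal projection `P`. -/
def coeff (P : minimalProjections A) (x : A) : ℂ :=
  inner ℂ (unitVector P) (toL2 x (unitVector P))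

theorem coeff_add (P : minimalProjections A) (x y : A) :
    coeff P (x + y) = coeff P x + coeff P y :=
  inner_add_right (𝕜 := ℂ) (unitVector P) (toL2 x (unitVector P)) (toL2 y (unitVector P))

theorem coeff_smul (P : minimalProjections A) (c : ℂ) (x : A) :
    coeff P (c • x) = c * coeff P x :=
  inner_smul_right (𝕜 := ℂ) (unitVector P) (toL2 x (unitVector P)) c

theorem coeff_star (P : minimalProjections A) (x : A) : coeff P (star x) = star (coeff P x) := by
  have h : ((star x : A) : SmoothOp) = star (x : SmoothOp) := rfl
  rw [coeff, h, toL2_star, ContinuousLinearMap.adjoint_inner_right]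
  exact (inner_conj_symm _ _).symm

theorem coeff_self (P : minimalProjections A) : coeff P (P : A) = 1 := by
  rw [coeff, apply_unitVector, inner_unitVector_self]

/-- Links the two descriptions of the coefficient: the inner product yields linearity and
continuity, the eigenvalue relation yields multiplicativity. -/
theorem coeff_eq_of_mul_eq (P : minimalProjections A) {x : A} {c : ℂ} (h : x * P = c • (P : A)) :
    coeff P x = c := by
  have h1 : toL2 x (toL2 P (unitVector P)) = c • toL2 P (unitVector P) :=
    congrArg (fun y : A => toL2 y (unitVector P)) h
  rw [apply_unitVector] at h1
  rw [coeff, h1, inner_smul_right, inner_unitVector_self, mul_one]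

theorem continuous_coeff (P : minimalProjections A) : Continuous (coeff P) := by
  have h : Continuous fun x : A => toL2 x (unitVector P) :=
    (ContinuousLinearMap.apply ℂ L2 (unitVector P)).continuous.comp
      (continuous_toL2.comp continuous_subtype_val)
  exact continuous_const.inner h

section Commutative

variable (hcomm : ∀ x ∈ A, ∀ y ∈ A, x * y = y * x)
include hcomm

theorem coeff_of_ne {P Q : minimalProjections A} (h : P ≠ Q) : coeff P (Q : A) = 0 := by
  refine coeff_eq_of_mul_eq P ?_
  rw [zero_smul]
  exact mul_eq_zero_of_minimal hcomm Q.2 P.2 (Subtype.coe_injective.ne h.symm)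

theorem orthonormal_unitVector : Orthonormal ℂ (unitVector (A := A)) := by
  refine ⟨norm_unitVector, fun P Q h => ?_⟩
  show inner ℂ (unitVector P) (unitVector Q) = 0
  have h1 : toL2 P (toL2 Q (unitVector Q)) = 0 :=
    congrArg (fun y : A => toL2 y (unitVector Q))
      (mul_eq_zero_of_minimal hcomm P.2 Q.2 (Subtype.coe_injective.ne h))
  rw [apply_unitVector] at h1
  rw [← apply_unitVector P, inner_apply_eq (star_projection P.2.1), h1, inner_zero_right]

/-- By Bessel's inequality, for each `j` only countably many of the orthonormal vectors `unitVector
P` have a nonzero `j`-th coordinate, and each has one for some `j`. -/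
theorem countable_minimalProjections : (minimalProjections A).Countable := by
  have h : (⋃ j : ℕ, Function.support fun P : minimalProjections A =>
      ‖inner ℂ (unitVector P) (basisVec j)‖ ^ 2) = Set.univ := by
    refine Set.eq_univ_of_forall fun P => Set.mem_iUnion.2 ?_
    by_contra! h
    have h0 : unitVector P = 0 := by
      refine lp.ext (funext fun j => ?_)
      have h1 := h j
      rw [Function.notMem_support, lp.inner_single_right] at h1
      simpa using h1
    have := norm_unitVector P
    rw [h0, norm_zero] at this
    exact zero_ne_one this
  rw [Set.countable_coe_iff.symm, ← Set.countable_univ_iff, ← h]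
  refine Set.countable_iUnion fun j => ?_
  exact ((orthonormal_unitVector hcomm).inner_products_summable (basisVec j)).countable_support

variable (hA : IsClosed (A : Set SmoothOp))
include hA

theorem mul_minimal_eq (P : minimalProjections A) (x : A) : x * P = coeff P x • (P : A) := by
  obtain ⟨c, hc⟩ := exists_mul_minimal_eq_smul hcomm hA P.2 x
  rw [coeff_eq_of_mul_eq P hc, hc]

theorem coeff_mul (P : minimalProjections A) (x y : A) :
    coeff P (x * y) = coeff P x * coeff P y := by
  refine coeff_eq_of_mul_eq P ?_
  rw [mul_assoc, mul_minimal_eq hcomm hA P y, mul_smul_comm, mul_minimal_eq hcomm hA P x, smul_smul,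
    mul_comm]

end Commutative

/-! ### Partial sums of minimal projections, and a Neumann series for characters. -/

/-- The minimal projections among the first `n` terms of the enumeration `ν`. -/
def initial (ν : minimalProjections A ↪ ℕ) (n : ℕ) : Finset (minimalProjections A) :=
  (Finset.range n).preimage ν ν.injective.injOn

theorem eventually_mem_initial (ν : minimalProjections A ↪ ℕ) (P : minimalProjections A) :
    ∀ᶠ n in atTop, P ∈ initial ν n := by
  filter_upwards [eventually_gt_atTop (ν P)] with n hn
  simpa [initial] using hn

/-- The sum of a finite set of minimal projections. -/
def sumProjection (s : Finset (minimalProjections A)) : A := ∑ P ∈ s, (P : A)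

theorem star_sumProjection (s : Finset (minimalProjections A)) :
    star (sumProjection s) = sumProjection s := by
  rw [sumProjection, star_sum]
  exact Finset.sum_congr rfl fun P _ => star_projection P.2.1

/-- The vectors `v` of `ℓ²` for which the sum of `P v` over the minimal projections `P`, in the
order of the enumeration, converges to `v`. -/
def essentialSpace (ν : minimalProjections A ↪ ℕ) : Submodule ℂ L2 where
  carrier := {v | Tendsto (fun n => toL2 (sumProjection (initial ν n) : A) v) atTop (𝓝 v)}
  add_mem' {u v} hu hv := by
    simp only [Set.mem_ofPred_eq, map_add] at hu hv ⊢
    exact hu.add hv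
  zero_mem' := by simp
  smul_mem' c v hv := by
    simp only [Set.mem_ofPred_eq, map_smul] at hv ⊢
    exact hv.const_smul c

theorem mem_essentialSpace {ν : minimalProjections A ↪ ℕ} {v : L2} : v ∈ essentialSpace ν ↔
    Tendsto (fun n => toL2 (sumProjection (initial ν n) : A) v) atTop (𝓝 v) := Iff.rfl

theorem toL2_coe_add_apply (x y : A) (v : L2) :
    toL2 ((x + y : A) : SmoothOp) v = toL2 x v + toL2 y v := rfl

theorem toL2_coe_smul_apply (c : ℂ) (x : A) (v : L2) :
    toL2 ((c • x : A) : SmoothOp) v = c • toL2 x v := rfl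

theorem toL2_coe_mul_apply (x y : A) (v : L2) :
    toL2 ((x * y : A) : SmoothOp) v = toL2 x (toL2 y v) := rfl

theorem toL2_sub_apply (x y : SmoothOp) (v : L2) : toL2 (x - y) v = toL2 x v - toL2 y v := rfl

/-- A multiplicative functional on `A` does not take the value `1` at an element of `ℓ²`-norm
less than `1`. -/
theorem ne_one_of_norm_toL2_lt_one (hA : IsClosed (A : Set SmoothOp)) (φ : A →⋆ₙₐ[ℂ] ℂ) {e : A}
    (he : ‖toL2 e‖ < 1) : φ e ≠ 1 := by
  intro h1
  set T := toL2 (e : SmoothOp) with hT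
  have hs : HasSum (fun n => T ^ n) (∑' n, T ^ n) :=
    (summable_geometric_of_norm_lt_one he).hasSum
  set R := ∑' n, T ^ n with hR
  have hRT : R * (1 - T) = 1 := geom_series_mul_neg T he
  have hlim := hs.tendsto_sum_nat
  obtain ⟨M, hM⟩ := hlim.norm.bddAbove_range
  -- `w = e R e` is the series `e² + e³ + ⋯`. The outer factors keep it in `A`, where `R` itself
  -- need not correspond to any element.
  have hmem : sandwich e R e ∈ A :=
    sandwich_mem_of_tendsto (R := fun n => ∑ k ∈ Finset.range n, T ^ k) (M := M) hA e.2 e.2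
      (fun n => sum_mem fun _ _ => pow_mem (toL2_mem_multipliers e.2) _)
      (fun n => hM ⟨n, rfl⟩)
      (fun v => ((ContinuousLinearMap.apply ℂ L2 v).continuous.tendsto R).comp hlim)
  set w : A := ⟨sandwich e R e, hmem⟩ with hw
  -- Applying `φ` with `φ e = 1` turns this identity into `φ w = φ w + 1`; no continuity of `φ`
  -- enters.
  have hkey : w = w * e + e * e := by
    refine Subtype.ext (toL2_injective ?_)
    show T * (R * T) = T * (R * T) * T + T * T
    have : R * T = R * T * T + T := by
      calc R * T = R * (1 - T) * T + R * T * T := by noncomm_ring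
        _ = _ := by rw [hRT, one_mul, add_comm]
    conv_lhs => rw [this]
    noncomm_ring
  have := congrArg φ hkey
  rw [map_add, map_mul, map_mul, h1] at this
  simp at this

/-! ### Convergence of the expansion. -/

section Commutative

variable (hcomm : ∀ x ∈ A, ∀ y ∈ A, x * y = y * x)
include hcomm

theorem sumProjection_mul_of_mem {s : Finset (minimalProjections A)} {P : minimalProjections A}
    (hP : P ∈ s) : sumProjection s * (P : A) = P := by
  rw [sumProjection, Finset.sum_mul, Finset.sum_eq_single_of_mem P hP]
  · exact projection_mul_self P.2.1
  · exact fun Q _ h => mul_eq_zero_of_minimal hcomm Q.2 P.2 (Subtype.coe_injective.ne h)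

theorem isStarProjection_sumProjection (s : Finset (minimalProjections A)) :
    IsStarProjection (toL2 (sumProjection s : A)) := by
  refine isStarProjection_toL2_iff.2 ⟨congrArg Subtype.val (?_ : sumProjection s *
    sumProjection s = sumProjection s), congrArg Subtype.val (star_sumProjection s)⟩
  conv_lhs => enter [2]; rw [sumProjection]
  rw [Finset.mul_sum]
  exact Finset.sum_congr rfl fun P hP => sumProjection_mul_of_mem hcomm hP

/-- The partial sums are orthogonal projections, hence uniformly `1`-Lipschitz, and for an
equicontinuous sequence the set of convergence to a continuous limit is closed. -/
theorem isClosed_essentialSpace (ν : minimalProjections A ↪ ℕ) :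
    IsClosed (essentialSpace ν : Set L2) := by
  refine Equicontinuous.isClosed_setOfPred_tendsto ?_ continuous_id
  refine (LipschitzWith.uniformEquicontinuous _ 1 fun n => ?_).equicontinuous
  exact ContinuousLinearMap.lipschitzWith_of_opNorm_le
    ((isStarProjection_sumProjection hcomm _).norm_le)

theorem range_minimal_le_essentialSpace (ν : minimalProjections A ↪ ℕ) {P : A}
    (hP : P ∈ minimalProjections A) (v : L2) : toL2 P v ∈ essentialSpace ν := by
  refine mem_essentialSpace.2 (tendsto_const_nhds.congr' ?_)
  filter_upwards [eventually_mem_initial ν ⟨P, hP⟩] with n hn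
  exact (congrArg (fun y : A => toL2 y v) (sumProjection_mul_of_mem hcomm hn)).symm

theorem range_projection_le_essentialSpace (ν : minimalProjections A ↪ ℕ) {Q : A}
    (hQ : Q ∈ projections A) : ∀ v, toL2 Q v ∈ essentialSpace ν :=
  projection_induction (p := fun Q : A => ∀ v, toL2 Q v ∈ essentialSpace ν)
    (fun _ hP => range_minimal_le_essentialSpace hcomm ν hP)
    (fun P Q hP hQ v => by
      rw [toL2_coe_add_apply]
      exact add_mem (hP v) (hQ v)) hQ

/-- Uniqueness of the expansion: `coeff P` is continuous, and by biorthogonality its values on the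
partial sums are `c P` as soon as `P` has been enumerated. -/
theorem coeff_eq_of_seriesConvergesTo {ν : minimalProjections A ↪ ℕ} {x : A}
    {c : minimalProjections A → ℂ}
    (h : SeriesConvergesTo (fun P : minimalProjections A => (P : A)) ν c x)
    (P : minimalProjections A) : coeff P x = c P := by
  classical
  refine tendsto_nhds_unique (((continuous_coeff P).tendsto x).comp h)
    (tendsto_const_nhds.congr' ?_)
  filter_upwards [eventually_mem_initial ν P] with n hn
  let f : A →+ ℂ := ⟨⟨coeff P, by simpa using coeff_smul P 0 0⟩, coeff_add P⟩
  show c P = f (∑ Q ∈ initial ν n, c Q • (Q : A))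
  rw [map_sum, Finset.sum_eq_single_of_mem P hn]
  · show c P = coeff P _
    rw [coeff_smul, coeff_self, mul_one]
  · intro Q _ hQ
    show coeff P _ = 0
    rw [coeff_smul, coeff_of_ne hcomm hQ.symm, mul_zero]

variable (hA : IsClosed (A : Set SmoothOp))
include hA

/-- The eigenvectors of the compact self-adjoint `y` span a dense subspace. Those for `μ ≠ 0` lie in
the range of a projection of `A`, those for `μ = 0` are sent to `0`, and the preimage of the
essential space under `y` is closed. -/
theorem apply_mem_essentialSpace_of_star_eq (ν : minimalProjections A ↪ ℕ) {y : A}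
    (hy : star y = y) (v : L2) : toL2 y v ∈ essentialSpace ν := by
  have hsa : star (y : SmoothOp) = y := congrArg Subtype.val hy
  have hT : IsSelfAdjoint (toL2 y) := by
    rw [ContinuousLinearMap.isSelfAdjoint_iff', ← toL2_star, hsa]
  have hdense := Submodule.topologicalClosure_eq_top_iff.2
    (ContinuousLinearMap.orthogonalComplement_iSup_eigenspaces_eq_bot
      (isCompactOperator_toL2 y) hT.isSymmetric)
  have hle : (⨆ μ, Module.End.eigenspace (toL2 y : Module.End ℂ L2) μ) ≤
      (essentialSpace ν).comap (toL2 y).toLinearMap := by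
    refine iSup_le fun μ u hu => ?_
    rw [Module.End.mem_eigenspace_iff] at hu
    change toL2 y u = μ • u at hu
    show toL2 y u ∈ essentialSpace ν
    by_cases hu0 : u = 0
    · rw [hu0, map_zero]
      exact zero_mem _
    by_cases hμ0 : μ = 0
    · rw [hu, hμ0, zero_smul]
      exact zero_mem _
    have hre : (μ.re : ℂ) = μ := Complex.conj_eq_iff_re.1
      (hT.isSymmetric.conj_eigenvalue_eq_self (Module.End.hasEigenvalue_of_hasEigenvector
        (x := u) ⟨Module.End.mem_eigenspace_iff.2 hu, hu0⟩))
    obtain ⟨Q, hQA, hQ, hQv⟩ := exists_eigenprojection hA y.2 hsa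
      (fun h : μ.re = 0 => hμ0 (by rw [← hre, h, Complex.ofReal_zero]))
    have hQu : toL2 Q u = u := (hQv u).2 (by rw [hre, hu])
    have hQm : (⟨Q, hQA⟩ : A) ∈ projections A := by
      refine ⟨fun h => hu0 ?_, hQ⟩
      rw [← hQu, show Q = 0 from congrArg Subtype.val h]
      rfl
    rw [hu]
    refine Submodule.smul_mem _ _ ?_
    have := range_projection_le_essentialSpace hcomm ν hQm u
    rwa [show toL2 ((⟨Q, hQA⟩ : A) : SmoothOp) u = u from hQu] at this
  have hcl : IsClosed ((essentialSpace ν).comap (toL2 y).toLinearMap : Set L2) :=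
    (isClosed_essentialSpace hcomm ν).preimage (toL2 y).continuous
  have := Submodule.topologicalClosure_minimal _ hle hcl
  rw [hdense] at this
  exact this Submodule.mem_top

theorem apply_mem_essentialSpace (ν : minimalProjections A ↪ ℕ) (x : A) (v : L2) :
    toL2 x v ∈ essentialSpace ν := by
  rw [← realPart_add_I_smul_imaginaryPart x, toL2_coe_add_apply, toL2_coe_smul_apply]
  exact add_mem (apply_mem_essentialSpace_of_star_eq hcomm hA ν (realPart x).2 v)
    (Submodule.smul_mem _ Complex.I
      (apply_mem_essentialSpace_of_star_eq hcomm hA ν (imaginaryPart x).2 v))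

/-- With `E_n` the sum of the first minimal projections, the partial sum is `E_n x`. The error `-(1
- E_n) x` is dominated by `x`, its adjoint by `star x` thanks to commutativity, and it tends to `0`
strongly. -/
theorem seriesConvergesTo_coeff (ν : minimalProjections A ↪ ℕ) (x : A) :
    SeriesConvergesTo (fun P : minimalProjections A => (P : A)) ν (fun P => coeff P x) x := by
  have hE : ∀ n, ∑ P ∈ initial ν n, coeff P x • (P : A) = sumProjection (initial ν n) * x := by
    intro n
    rw [mul_comm_of_forall hcomm, sumProjection, Finset.mul_sum]
    exact Finset.sum_congr rfl fun P _ => (mul_minimal_eq hcomm hA P x).symm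
  rw [SeriesConvergesTo, tendsto_subtype_rng, ← tendsto_sub_nhds_zero_iff]
  change Tendsto (fun n => ((∑ P ∈ initial ν n, coeff P x • (P : A) : A) : SmoothOp) - x) _ _
  simp only [hE]
  have happly : ∀ (y : A) (s : Finset (minimalProjections A)) (v : L2),
      ‖toL2 ((sumProjection s * y : A) : SmoothOp) v - toL2 y v‖ ≤ ‖toL2 y v‖ := fun y s v => by
    have h1 : toL2 ((sumProjection s * y : A) : SmoothOp) v - toL2 y v =
        -((1 - toL2 (sumProjection s : A)) (toL2 y v)) := by
      rw [toL2_coe_mul_apply, sub_apply, neg_sub]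
      rfl
    rw [h1, norm_neg]
    simpa using ContinuousLinearMap.le_of_opNorm_le _
      ((isStarProjection_sumProjection hcomm s).one_sub.norm_le) (toL2 y v)
  refine tendsto_zero_of_dominated _ x (star x : SmoothOp) (fun n j => ?_)
    (fun n j => ?_) fun v => ?_
  · rw [toL2_sub_apply]
    exact happly x _ _
  · have : star (((sumProjection (initial ν n) * x : A) : SmoothOp) - x) =
        ((sumProjection (initial ν n) * star x : A) : SmoothOp) - star (x : SmoothOp) := by
      rw [star_sub]
      congr 1
      show ((star (sumProjection (initial ν n) * x) : A) : SmoothOp) = _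
      rw [star_mul, star_sumProjection, mul_comm_of_forall hcomm]
    rw [this, toL2_sub_apply]
    exact happly (star x) _ _
  · have := mem_essentialSpace.1 (apply_mem_essentialSpace hcomm hA ν x v)
    simp only [toL2_sub_apply, toL2_coe_mul_apply]
    exact tendsto_sub_nhds_zero_iff.2 this

theorem isCoeffFunctional_iff {ν : minimalProjections A ↪ ℕ} {P : minimalProjections A}
    {f : A → ℂ} :
    IsCoeffFunctional (fun P : minimalProjections A => (P : A)) ν P f ↔ f = coeff P :=
  ⟨fun h => funext fun x => h x _ (seriesConvergesTo_coeff hcomm hA ν x),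
    fun h _ _ hc => h ▸ coeff_eq_of_seriesConvergesTo hcomm hc P⟩

theorem isSchauderBasis_minimalProjections (ν : minimalProjections A ↪ ℕ) :
    IsSchauderBasis (fun P : minimalProjections A => (P : A)) ν where
  existsUnique_expansion x := ⟨fun P => coeff P x, seriesConvergesTo_coeff hcomm hA ν _,
    fun _ hc => funext fun P => (coeff_eq_of_seriesConvergesTo hcomm hc P).symm⟩
  continuous_coeff P _ hf := (isCoeffFunctional_iff hcomm hA).1 hf ▸ continuous_coeff P

/-! ### The characters of `A`. -/

/-- The coefficient functional of a minimal projection, as a character. -/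
def coeffHom (P : minimalProjections A) : A →⋆ₙₐ[ℂ] ℂ where
  toFun := coeff P
  map_smul' c x := coeff_smul P c x
  map_zero' := by simpa using coeff_smul P 0 0
  map_add' := coeff_add P
  map_mul' := coeff_mul hcomm hA P
  map_star' := coeff_star P

/-- If `φ` killed every minimal projection, subtracting a partial sum from `e` with `φ e = 1` would
keep the value `1` while making the `ℓ²`-norm less than `1`. -/
theorem exists_minimal_apply_ne_zero (ν : minimalProjections A ↪ ℕ) {φ : A →⋆ₙₐ[ℂ] ℂ}
    (hφ : φ ≠ 0) : ∃ P : minimalProjections A, φ P ≠ 0 := by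
  by_contra! h
  obtain ⟨x, hx⟩ : ∃ x, φ x ≠ 0 := by
    by_contra! h0
    exact hφ (NonUnitalStarAlgHom.ext h0)
  set e : A := (φ x)⁻¹ • x with he
  have he1 : φ e = 1 := by
    rw [he, map_smul, smul_eq_mul, inv_mul_cancel₀ hx]
  have hlim := seriesConvergesTo_coeff hcomm hA ν e
  have hnorm : Tendsto (fun n => ‖toL2 ((∑ P ∈ initial ν n, coeff P e • (P : A) : A) : SmoothOp) -
      toL2 e‖) atTop (𝓝 0) := by
    refine tendsto_iff_norm_sub_tendsto_zero.1 ?_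
    exact ((continuous_toL2.comp continuous_subtype_val).tendsto e).comp hlim
  obtain ⟨n, hn⟩ := (hnorm.eventually_lt_const one_pos).exists
  refine ne_one_of_norm_toL2_lt_one hA φ
    (e := e - ∑ P ∈ initial ν n, coeff P e • (P : A)) ?_ ?_
  · rw [norm_sub_rev] at hn
    exact hn
  · rw [map_sub, he1, map_sum, Finset.sum_eq_zero, sub_zero]
    intro P _
    rw [map_smul, h P, smul_zero]

theorem eq_coeff_of_ne_zero (φ : A →⋆ₙₐ[ℂ] ℂ) {P : minimalProjections A} (hP : φ P ≠ 0) (x : A) :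
    φ x = coeff P x := by
  have := congrArg φ (mul_minimal_eq hcomm hA P x)
  rw [map_mul, map_smul, smul_eq_mul] at this
  exact mul_right_cancel₀ hP this

end Commutative

end

end SmoothOps

theorem mainTheorem9 (A : NonUnitalStarSubalgebra ℂ SmoothOps.SmoothOp)
    (hclosed : IsClosed (A : Set SmoothOps.SmoothOp))
    (hcomm : ∀ x ∈ A, ∀ y ∈ A, x * y = y * x) :
    (SmoothOps.minimalProjections A).Countable ∧
      ∀ ν : SmoothOps.minimalProjections A ↪ ℕ,
        SmoothOps.IsSchauderBasis (fun P : SmoothOps.minimalProjections A => (P : A)) ν ∧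
        {f : A → ℂ | ∃ φ : A →⋆ₙₐ[ℂ] ℂ, φ ≠ 0 ∧ f = φ} =
          {f : A → ℂ | ∃ P : SmoothOps.minimalProjections A,
            SmoothOps.IsCoeffFunctional (fun P : SmoothOps.minimalProjections A => (P : A)) ν P f} := by
  refine ⟨SmoothOps.countable_minimalProjections hcomm, fun ν =>
    ⟨SmoothOps.isSchauderBasis_minimalProjections hcomm hclosed ν, Set.ext fun f => ?_⟩⟩
  simp only [Set.mem_ofPred_eq, SmoothOps.isCoeffFunctional_iff hcomm hclosed]
  constructor
  · rintro ⟨φ, hφ, rfl⟩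
    obtain ⟨P, hP⟩ := SmoothOps.exists_minimal_apply_ne_zero hcomm hclosed ν hφ
    exact ⟨P, funext (SmoothOps.eq_coeff_of_ne_zero hcomm hclosed φ hP)⟩
  · rintro ⟨P, rfl⟩
    refine ⟨SmoothOps.coeffHom hcomm hclosed P, fun h => one_ne_zero (α := ℂ) ?_, rfl⟩
    rw [← SmoothOps.coeff_self P]
    exact DFunLike.congr_fun h (P : A)
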